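/- Let $d\ge 1$, $0\le k\le n$, put $\bar d=d$ for $d$ odd and $\bar d=2d$ for $d$ even, let $\zeta\in\mathbb C$ be a primitive $\bar d$-th root of unity and $\xi=\zeta^2$. On $\mathbb C^d$ with orthonormal basis $(v_i)_{i\in\mathbb Z/d}$ let $Xv_i=v_{i+1}$, $Zv_i=\xi^iv_i$. Let $\mathcal P_n\subset GL(V)$, $V=(\mathbb C^d)^{\otimes n}$, be the Pauli group, generated by the operators $X_r,Z_r$ ($X,Z$ acting on the $r$-th factor) and the scalar $\zeta$. Let $\mathcal M$ be the free $\mathbb Z/d$-module with basis $z_1,\dots,z_n,x_1,\dots,x_n$ and with the symplectic form $\phi(z_i,z_j)=\phi(x_i,x_j)=0$, $\phi(z_i,x_j)=-\phi(x_j,z_i)=\delta_{ij}$, and let $\tau:\mathcal P_n\to\mathcal M$ be the homomorphism with $Z_r\mapsto z_r$, $X_r\mapsto x_r$, $\zeta\mapsto 0$. For a positive divisor $c$ of $d$ let $S_c=\mathbb Z/c\oplus\mathbb Z/c$ with the alternating $\mathbb Z/d$-valued form with $\phi((1,0),(0,1))=d/c$. Let $\mathcal P_1^{(c,\zeta)}\subset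 GL(\mathbb C^c)$ be the group generated by the one-qudit Pauli group of dimension $c$ (formed with a primitive $\bar c$-th root of unity) and the scalar $\zeta$. Let $\times_\zeta$ denote the direct product of groups modulo the identification of the elements $\zeta$ of the factors. Let $(e_1,\dots,e_n,f_1,\dots,f_n)$ be a symplectic basis of $\mathcal M$ (that is, $\phi(e_i,e_j)=\phi(f_i,f_j)=0$, $\phi(e_i,f_j)=\delta_{ij}$), and let $Z'_1,\dots,Z'_n,X'_1,\dots,X'_n\in\mathcal P_n$ be lifts of it along $\tau$ that satisfy the relations of the standard generators (equivalently, $Z_i'^d=X_i'^d=1$ for all $i$). Let $a_r,b_r$ ($1\le r\le k$) be positive divisors of $d$ with $d\mid a_rb_r$, put $c_r=a_rb_r/d$ (a divisor of $d$), and let $H$ be the twisted free subgroup $$H=\langle Z_1'^{a_1},\dots,Z_k'^{a_k},X_1'^{b_1},\dots,X_k'^{b_k}\rangle\subset\mathcal P_n .$$ Let $N(H)$ be the normaliser of $H$ in $\mathcal P_n$ and $V^H$ the subspace of the vectors of $V$ fixed by $H$. Then $\tau(H)\subset\tau(H)^\perp$, and: 1. there is an isomorphism, respecting the forms, $\tau(H)^\perp/\tau(H)\simeq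 S_{c_1}\oplus\dots\oplus S_{c_k}\oplus S_d^{\oplus(n-k)}$ (orthogonal direct sum); 2. there are an isomorphism of groups $$N(H)/H\simeq\mathcal P_1^{(c_1,\zeta)}\times_\zeta\dots\times_\zeta\mathcal P_1^{(c_k,\zeta)}\times_\zeta\mathcal P_{n-k}$$ that sends the class of $\zeta$ to $\zeta$, and a unitary isomorphism $$V^H\simeq\mathbb C^{c_1}\otimes\dots\otimes\mathbb C^{c_k}\otimes(\mathbb C^d)^{\otimes(n-k)}$$ that intertwines the action of $N(H)/H$ on $V^H$ with the tensor product action of the $\zeta$-product. -/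

import Mathlib

open Matrix

noncomputable section

namespace QuditPauli

/-! ### Qudits, tensor products and Pauli groups

The space `ℂ^m` has the orthonormal basis `v_j`, `j : Fin m`.  A tensor product
`⨂_i ℂ^(m i)` is the space with the orthonormal basis `⨂_i v_(j i)`, indexed by the families
`j : ∀ i, Fin (m i)`; operators on it are matrices indexed by such families. -/

/-- `d̄ = d` for odd `d`, and `d̄ = 2 d` for even `d`. -/
def dbar (d : ℕ) : ℕ := if Odd d then d else 2 * d

/-- The operator `X` on `ℂ^m`: `X v_j = v_(j+1)`, the indices being taken modulo `m`. -/
def shiftX (m : ℕ) : GL (Fin m) ℂ where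
  val := Matrix.of fun i j => if i = finRotate m j then 1 else 0
  inv := Matrix.of fun i j => if finRotate m i = j then 1 else 0
  val_inv := by
    ext i j
    rw [Matrix.mul_apply, Finset.sum_eq_single ((finRotate m).symm j)]
    · simp only [Matrix.of_apply, Equiv.apply_symm_apply, if_true, mul_one, Matrix.one_apply]
    · intro k _ hk
      have : finRotate m k ≠ j := fun h => hk ((Equiv.eq_symm_apply _).mpr h)
      simp only [Matrix.of_apply, this, if_false, mul_zero]
    · simp
  inv_val := by
    ext i j
    simp [Matrix.mul_apply, Matrix.one_apply]

/-- The operator `Z` on `ℂ^m` attached to a root of unity `ω`: `Z v_j = ω^j v_j`. -/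
def clockZ (m : ℕ) (ω : ℂˣ) : GL (Fin m) ℂ where
  val := Matrix.diagonal fun j => ((ω ^ (j : ℕ) : ℂˣ) : ℂ)
  inv := Matrix.diagonal fun j => (((ω ^ (j : ℕ))⁻¹ : ℂˣ) : ℂ)
  val_inv := by
    rw [Matrix.diagonal_mul_diagonal, ← Matrix.diagonal_one]
    congr 1; ext j; rw [← Units.val_mul]; simp
  inv_val := by
    rw [Matrix.diagonal_mul_diagonal, ← Matrix.diagonal_one]
    congr 1; ext j; rw [← Units.val_mul]; simp

/-- Multiplication by the scalar `ω`. -/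
def scalarGL (J : Type*) [Fintype J] [DecidableEq J] : ℂˣ →* GL J ℂ :=
  Units.map (Matrix.scalar J : ℂ →+* Matrix J J ℂ).toMonoidHom

/-- The tensor product `⨂_i A i` of matrices, `(⨂_i A i) (⨂_i v_(j i)) = ⨂_i (A i v_(j i))`. -/
def tensorMat {ι : Type*} [Fintype ι] [DecidableEq ι] (m : ι → ℕ) :
    (∀ i, Matrix (Fin (m i)) (Fin (m i)) ℂ) →*
      Matrix (∀ i, Fin (m i)) (∀ i, Fin (m i)) ℂ where
  toFun A := Matrix.of fun p q => ∏ i, A i (p i) (q i)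
  map_one' := by
    ext p q
    by_cases h : p = q
    · subst h; simp
    · obtain ⟨i, hi⟩ := Function.ne_iff.mp h
      rw [Matrix.of_apply, Matrix.one_apply_ne h]
      exact Finset.prod_eq_zero (Finset.mem_univ i) (by simp [hi])
  map_mul' A B := by
    ext p q
    simp only [Matrix.of_apply, Pi.mul_apply, Matrix.mul_apply, Finset.prod_univ_sum,
      Fintype.piFinset_univ, Finset.prod_mul_distrib]

/-- The tensor product of invertible operators. -/
def tensorGL {ι : Type*} [Fintype ι] [DecidableEq ι] (m : ι → ℕ) :
    (∀ i, GL (Fin (m i)) ℂ) →* GL (∀ i, Fin (m i)) ℂ :=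
  (Units.map (tensorMat m)).comp MulEquiv.piUnits.symm.toMonoidHom

/-- `A` acting on the `r`-th of `n` qudits: `I ⊗ ⋯ ⊗ I ⊗ A ⊗ I ⊗ ⋯ ⊗ I`. -/
def onQudit (d n : ℕ) (r : Fin n) : GL (Fin d) ℂ →* GL (Fin n → Fin d) ℂ :=
  (tensorGL fun _ : Fin n => d).comp (MonoidHom.mulSingle (fun _ : Fin n => GL (Fin d) ℂ) r)

/-- The Pauli group of one qudit of dimension `d`, as a subgroup of `GL(ℂ^d)`;
`ζ` is a primitive `d̄`-th root of unity. -/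
def pauliOne (d : ℕ) (ζ : ℂˣ) : Subgroup (GL (Fin d) ℂ) :=
  Subgroup.closure {shiftX d, clockZ d (ζ ^ 2), scalarGL (Fin d) ζ}

/-- The Pauli group of `n` qudits of dimension `d`, as a subgroup of `GL((ℂ^d)^{⊗ n})`;
`ζ` is a primitive `d̄`-th root of unity. -/
def pauli (d n : ℕ) (ζ : ℂˣ) : Subgroup (GL (Fin n → Fin d) ℂ) :=
  Subgroup.closure
    (Set.range (fun r => onQudit d n r (clockZ d (ζ ^ 2))) ∪
      Set.range (fun r => onQudit d n r (shiftX d)) ∪ {scalarGL (Fin n → Fin d) ζ})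

/-- For a divisor `c` of `d` and a primitive `d̄`-th root of unity `ζ`: the group
`P_1^{(c,ζ)} ⊆ GL(ℂ^c)` generated by the Pauli group of one qudit of dimension `c` (formed with the
primitive `c̄`-th root of unity `ζ^(d̄/c̄)`) and by the scalar `ζ`. -/
def pauliOneExt (d c : ℕ) (ζ : ℂˣ) : Subgroup (GL (Fin c) ℂ) :=
  pauliOne c (ζ ^ (dbar d / dbar c)) ⊔ Subgroup.zpowers (scalarGL (Fin c) ζ)

/-- The scalar `ζ` as an element of the Pauli group. -/
def pauliZeta (d n : ℕ) (ζ : ℂˣ) : pauli d n ζ :=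
  ⟨scalarGL _ ζ, Subgroup.subset_closure (by simp)⟩

/-- The operator `Z_r` as an element of the Pauli group. -/
def pauliZ (d n : ℕ) (ζ : ℂˣ) (r : Fin n) : pauli d n ζ :=
  ⟨onQudit d n r (clockZ d (ζ ^ 2)), Subgroup.subset_closure (by simp)⟩

/-- The operator `X_r` as an element of the Pauli group. -/
def pauliX (d n : ℕ) (ζ : ℂˣ) (r : Fin n) : pauli d n ζ :=
  ⟨onQudit d n r (shiftX d), Subgroup.subset_closure (by simp)⟩

/-- The scalar `ζ` as an element of `P_1^{(c,ζ)}`. -/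
def pauliOneExtZeta (d c : ℕ) (ζ : ℂˣ) : pauliOneExt d c ζ :=
  ⟨scalarGL _ ζ, Subgroup.mem_sup_right (Subgroup.mem_zpowers _)⟩

/-! ### The symplectic module of the Pauli group -/

/-- The free `ℤ/d`-module with basis `z_1, …, z_n, x_1, …, x_n`; an element is the pair of its
`z`-coordinates and its `x`-coordinates. -/
abbrev PhaseSpace (d n : ℕ) : Type := (Fin n → ZMod d) × (Fin n → ZMod d)

/-- The symplectic form with `φ(z_i, z_j) = φ(x_i, x_j) = 0`, `φ(z_i, x_j) = δ_ij`. -/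
def sympForm {d n : ℕ} (p q : PhaseSpace d n) : ZMod d :=
  ∑ r, (p.1 r * q.2 r - p.2 r * q.1 r)

/-- The graph of the homomorphism `τ` (see `tau`): the subgroup generated by the pairs
`(Z_r, z_r)`, `(X_r, x_r)`, `(ζ, 0)`. -/
def tauGraph (d n : ℕ) (ζ : ℂˣ) :
    Subgroup (GL (Fin n → Fin d) ℂ × Multiplicative (PhaseSpace d n)) :=
  Subgroup.closure
    (Set.range (fun r => (onQudit d n r (clockZ d (ζ ^ 2)),
        Multiplicative.ofAdd ((Pi.single r 1, 0) : PhaseSpace d n))) ∪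
      Set.range (fun r => (onQudit d n r (shiftX d),
        Multiplicative.ofAdd ((0, Pi.single r 1) : PhaseSpace d n))) ∪
      {(scalarGL (Fin n → Fin d) ζ, 1)})

lemma map_fst_tauGraph (d n : ℕ) (ζ : ℂˣ) :
    (tauGraph d n ζ).map (MonoidHom.fst _ _) = pauli d n ζ := by
  rw [tauGraph, MonoidHom.map_closure, Set.image_union, Set.image_union, ← Set.range_comp,
    ← Set.range_comp, Set.image_singleton]
  rfl

lemma scalarGL_comm {J : Type*} [Fintype J] [DecidableEq J] (ω : ℂˣ) (A : GL J ℂ) :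
    scalarGL J ω * A = A * scalarGL J ω := by
  ext1
  exact (Matrix.scalar_commute (ω : ℂ) (fun _ => mul_comm _ _) A.val)

lemma onQudit_comm {d n : ℕ} {r s : Fin n} (h : r ≠ s) (A B : GL (Fin d) ℂ) :
    onQudit d n r A * onQudit d n s B = onQudit d n s B * onQudit d n r A := by
  have := (Pi.mulSingle_commute (f := fun _ : Fin n => GL (Fin d) ℂ) h A B).map
    (tensorGL fun _ : Fin n => d)
  exact this

lemma onQudit_scalarGL {d n : ℕ} (r : Fin n) (ω : ℂˣ) :
    onQudit d n r (scalarGL _ ω) = scalarGL _ ω := by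
  ext p q
  change ∏ i, (Pi.mulSingle (M := fun _ : Fin n => GL (Fin d) ℂ) r (scalarGL _ ω) i).val (p i) (q i)
    = Matrix.scalar _ (ω : ℂ) p q
  rw [← Finset.mul_prod_erase _ _ (Finset.mem_univ r)]
  have h1 : ∀ i ∈ Finset.univ.erase r,
      (Pi.mulSingle (M := fun _ : Fin n => GL (Fin d) ℂ) r (scalarGL _ ω) i).val (p i) (q i)
        = if p i = q i then (1 : ℂ) else 0 := by
    intro i hi
    rw [Pi.mulSingle_eq_of_ne (Finset.ne_of_mem_erase hi), Units.val_one, Matrix.one_apply]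
  rw [Finset.prod_congr rfl h1, Pi.mulSingle_eq_same]
  change Matrix.scalar _ (ω : ℂ) (p r) (q r) * _ = _
  simp only [Matrix.scalar_apply, Matrix.diagonal_apply]
  by_cases h : p = q
  · subst h; simp
  · rw [if_neg h]
    obtain ⟨i, hi⟩ := Function.ne_iff.mp h
    by_cases hr : i = r
    · subst hr; rw [if_neg hi, zero_mul]
    · rw [Finset.prod_eq_zero (Finset.mem_erase.mpr ⟨hr, Finset.mem_univ i⟩) (if_neg hi), mul_zero]

lemma clockZ_mul_shiftX {d : ℕ} {ω : ℂˣ} (h : ω ^ d = 1) :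
    clockZ d ω * shiftX d = scalarGL _ ω * (shiftX d * clockZ d ω) := by
  cases d with
  | zero => ext i; exact i.elim0
  | succ d =>
    ext i j
    change ((clockZ (d + 1) ω).val * (shiftX (d + 1)).val) i j =
      (Matrix.scalar (Fin (d + 1)) (ω : ℂ) * ((shiftX (d + 1)).val * (clockZ (d + 1) ω).val)) i j
    simp only [clockZ, shiftX]
    rw [Matrix.scalar_apply, Matrix.diagonal_mul, Matrix.diagonal_mul, Matrix.mul_diagonal,
      Matrix.of_apply]
    by_cases hij : i = finRotate (d + 1) j
    · subst hij
      have : ω ^ ((finRotate (d + 1) j : Fin (d + 1)) : ℕ) = ω * ω ^ (j : ℕ) := by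
        rw [finRotate_apply, Fin.val_add, ← pow_succ']
        by_cases hd : d = 0
        · subst hd; simp at h; simp [h]
        · rw [Fin.val_one', Nat.add_mod_mod, ← pow_eq_pow_mod _ h]
      rw [this]
      simp
    · simp only [if_neg hij, zero_mul, mul_zero]

lemma scalarGL_injective {J : Type*} [Fintype J] [DecidableEq J] [Nonempty J] :
    Function.Injective (scalarGL J) := by
  intro a b h
  have h' := congrArg Units.val h
  exact Units.ext (Matrix.scalar_inj.mp h')

lemma tauGraph_commute {d n : ℕ} {ζ : ℂˣ} (B : GL (Fin n → Fin d) ℂ)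
    (χ : Multiplicative (PhaseSpace d n) →* ℂˣ)
    (hZ : ∀ r, onQudit d n r (clockZ d (ζ ^ 2)) * B =
      scalarGL _ (χ (Multiplicative.ofAdd (Pi.single r 1, 0))) *
        (B * onQudit d n r (clockZ d (ζ ^ 2))))
    (hX : ∀ r, onQudit d n r (shiftX d) * B =
      scalarGL _ (χ (Multiplicative.ofAdd (0, Pi.single r 1))) * (B * onQudit d n r (shiftX d)))
    {x : GL (Fin n → Fin d) ℂ × Multiplicative (PhaseSpace d n)} (hx : x ∈ tauGraph d n ζ) :
    x.1 * B = scalarGL _ (χ x.2) * (B * x.1) := by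
  induction hx using Subgroup.closure_induction with
  | mem y hy =>
    rcases hy with (⟨r, rfl⟩ | ⟨r, rfl⟩) | rfl
    · exact hZ r
    · exact hX r
    · simp [scalarGL_comm]
  | one => simp
  | mul y z _ _ hy hz =>
    simp only [Prod.fst_mul, Prod.snd_mul, map_mul]
    calc y.1 * z.1 * B = y.1 * (z.1 * B) := by group
      _ = (y.1 * scalarGL _ (χ z.2)) * (B * z.1) := by rw [hz]; group
      _ = scalarGL _ (χ z.2) * (y.1 * B) * z.1 := by rw [← scalarGL_comm]; group
      _ = _ := by rw [hy, ← scalarGL_comm (χ z.2) (scalarGL _ (χ y.2))]; group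
  | inv y _ hy =>
    simp only [Prod.fst_inv, Prod.snd_inv, map_inv]
    have h : y.1⁻¹ * (y.1 * B) * y.1⁻¹ = B * y.1⁻¹ := by group
    rw [hy, ← mul_assoc, ← scalarGL_comm] at h
    have h2 : scalarGL _ (χ y.2) * (y.1⁻¹ * B) = B * y.1⁻¹ := by rw [← h]; group
    rw [← h2]; group

/-- The homomorphism `m ↦ ξ^(ℓ m)` for an additive map `ℓ` to `ℤ/d` and `ξ^d = 1`. -/
def phaseChar {d : ℕ} [NeZero d] {M : Type*} [AddGroup M] {ξ : ℂˣ} (h : ξ ^ d = 1)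
    (l : M →+ ZMod d) : Multiplicative M →* ℂˣ :=
  (AddChar.zmodChar d h).toMonoidHom.comp l.toMultiplicative

lemma phaseChar_apply {d : ℕ} [NeZero d] {M : Type*} [AddGroup M] {ξ : ℂˣ} (h : ξ ^ d = 1)
    (l : M →+ ZMod d) (m : Multiplicative M) : phaseChar h l m = ξ ^ (l m.toAdd).val := rfl

lemma phaseChar_eq_one {d : ℕ} [NeZero d] {M : Type*} [AddGroup M] {ξ : ℂˣ}
    (h : IsPrimitiveRoot ξ d) (l : M →+ ZMod d) (m : Multiplicative M)
    (hm : phaseChar h.pow_eq_one l m = 1) : l m.toAdd = 0 := by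
  rw [phaseChar_apply, h.pow_eq_one_iff_dvd] at hm
  exact (ZMod.val_eq_zero _).mp (Nat.eq_zero_of_dvd_of_lt hm (ZMod.val_lt _))

lemma phaseChar_zero {d : ℕ} [NeZero d] {M : Type*} [AddGroup M] {ξ : ℂˣ} (h : ξ ^ d = 1)
    (l : M →+ ZMod d) (m : M) (hl : l m = 0) : phaseChar h l (Multiplicative.ofAdd m) = 1 := by
  rw [phaseChar_apply, toAdd_ofAdd, hl, ZMod.val_zero, pow_zero]

lemma phaseChar_one {d : ℕ} [NeZero d] {M : Type*} [AddGroup M] {ξ : ℂˣ} (h : ξ ^ d = 1)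
    (l : M →+ ZMod d) (m : M) (hl : l m = 1) : phaseChar h l (Multiplicative.ofAdd m) = ξ := by
  rw [phaseChar_apply, toAdd_ofAdd, hl, ZMod.val_one_eq_one_mod, ← pow_eq_pow_mod _ h, pow_one]

lemma isPrimitiveRoot_sq {d : ℕ} [NeZero d] {ζ : ℂˣ} (hζ : IsPrimitiveRoot ζ (dbar d)) :
    IsPrimitiveRoot (ζ ^ 2) d := by
  unfold dbar at hζ
  split_ifs at hζ with h
  · exact hζ.pow_of_coprime 2 (Nat.coprime_two_left.mpr h)
  · have := NeZero.pos d
    exact hζ.pow (by omega) rfl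

lemma tauGraph_snd_eq_one {d n : ℕ} [NeZero d] {ζ : ℂˣ} (hζ : IsPrimitiveRoot ζ (dbar d))
    {m : Multiplicative (PhaseSpace d n)} (h : (1, m) ∈ tauGraph d n ζ) : m = 1 := by
  have hξ := isPrimitiveRoot_sq hζ
  have key : clockZ d (ζ ^ 2) * shiftX d =
      scalarGL _ (ζ ^ 2) * (shiftX d * clockZ d (ζ ^ 2)) := clockZ_mul_shiftX hξ.pow_eq_one
  have hfin : ∀ (B : GL (Fin n → Fin d) ℂ) (l : PhaseSpace d n →+ ZMod d),
      (1 : GL (Fin n → Fin d) ℂ) * B = scalarGL _ (phaseChar hξ.pow_eq_one l m) * (B * 1) →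
      l m.toAdd = 0 := by
    intro B l hB
    apply phaseChar_eq_one hξ
    rw [mul_one] at hB
    exact scalarGL_injective ((mul_right_cancel hB).symm.trans (map_one _).symm)
  have hz : ∀ r, m.toAdd.1 r = 0 := by
    intro r
    let l : PhaseSpace d n →+ ZMod d := (Pi.evalAddMonoidHom _ r).comp (AddMonoidHom.fst _ _)
    refine hfin (onQudit d n r (shiftX d)) l
      (tauGraph_commute (x := (1, m)) _ (phaseChar hξ.pow_eq_one l) ?_ ?_ h)
    · intro s
      by_cases hs : s = r
      · subst hs
        rw [phaseChar_one _ _ _ (by simp [l]), ← map_mul, key, map_mul, map_mul,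
          onQudit_scalarGL]
      · rw [phaseChar_zero _ _ _ (by simp [l, Ne.symm hs]), map_one, one_mul, onQudit_comm hs]
    · intro s
      rw [phaseChar_zero _ _ _ (by simp [l]), map_one, one_mul]
      by_cases hs : s = r
      · rw [hs]
      · rw [onQudit_comm hs]
  have hx : ∀ r, m.toAdd.2 r = 0 := by
    intro r
    let l : PhaseSpace d n →+ ZMod d :=
      (-(Pi.evalAddMonoidHom (fun _ : Fin n => ZMod d) r)).comp (AddMonoidHom.snd _ _)
    suffices l m.toAdd = 0 by simpa [l] using this
    have hinv : ∀ p, phaseChar hξ.pow_eq_one l p =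
        (phaseChar hξ.pow_eq_one
          ((Pi.evalAddMonoidHom (fun _ : Fin n => ZMod d) r).comp (AddMonoidHom.snd _ _)) p)⁻¹ := by
      intro p
      exact AddChar.map_neg_eq_inv (AddChar.zmodChar d hξ.pow_eq_one) _
    refine hfin (onQudit d n r (clockZ d (ζ ^ 2))) l
      (tauGraph_commute (x := (1, m)) _ (phaseChar hξ.pow_eq_one l) ?_ ?_ h)
    · intro s
      rw [phaseChar_zero _ _ _ (by simp [l]), map_one, one_mul]
      by_cases hs : s = r
      · rw [hs]
      · rw [onQudit_comm hs]
    · intro s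
      by_cases hs : s = r
      · subst hs
        rw [hinv, phaseChar_one _ _ _ (by simp), ← map_mul, ← map_mul, key, map_mul (onQudit d n s) (scalarGL _ _),
          onQudit_scalarGL, map_inv, inv_mul_cancel_left]
      · rw [phaseChar_zero _ _ _ (by simp [l, Ne.symm hs]), map_one, one_mul, onQudit_comm hs]
  exact Multiplicative.toAdd.injective (Prod.ext (funext hz) (funext hx))

/-- The first projection identifies the graph of `τ` with the Pauli group. -/
def tauGraphEquiv (d n : ℕ) [NeZero d] {ζ : ℂˣ} (hζ : IsPrimitiveRoot ζ (dbar d)) :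
    tauGraph d n ζ ≃* pauli d n ζ :=
  MulEquiv.ofBijective
    (((MonoidHom.fst _ _).comp (tauGraph d n ζ).subtype).codRestrict (pauli d n ζ) (fun x => by
      rw [← map_fst_tauGraph]
      exact Subgroup.mem_map_of_mem _ x.2))
    ⟨by
      rw [injective_iff_map_eq_one]
      rintro ⟨⟨g, m⟩, hx⟩ h
      have hg : g = 1 := congrArg Subtype.val h
      subst hg
      have hm := tauGraph_snd_eq_one hζ hx
      subst hm
      rfl, by
      rintro ⟨g, hg⟩
      have hg' := hg
      rw [← map_fst_tauGraph] at hg'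
      obtain ⟨x, hx, rfl⟩ := hg'
      exact ⟨⟨x, hx⟩, rfl⟩⟩

/-- The homomorphism `τ` from the Pauli group to the symplectic module, with
`Z_r ↦ z_r`, `X_r ↦ x_r` and `ζ ↦ 0`. -/
def tau (d n : ℕ) [NeZero d] {ζ : ℂˣ} (hζ : IsPrimitiveRoot ζ (dbar d)) :
    pauli d n ζ →* Multiplicative (PhaseSpace d n) :=
  ((MonoidHom.snd _ _).comp (tauGraph d n ζ).subtype).comp (tauGraphEquiv d n hζ).symm.toMonoidHom

lemma tau_eq (d n : ℕ) [NeZero d] {ζ : ℂˣ} (hζ : IsPrimitiveRoot ζ (dbar d)) (g : pauli d n ζ)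
    (m : Multiplicative (PhaseSpace d n)) (h : ((g : GL (Fin n → Fin d) ℂ), m) ∈ tauGraph d n ζ) :
    tau d n hζ g = m := by
  have : (tauGraphEquiv d n hζ).symm g = ⟨(g, m), h⟩ := by
    rw [MulEquiv.symm_apply_eq]; rfl
  change ((tauGraphEquiv d n hζ).symm g).1.2 = m
  rw [this]

lemma tau_pauliZ (d n : ℕ) [NeZero d] {ζ : ℂˣ} (hζ : IsPrimitiveRoot ζ (dbar d)) (r : Fin n) :
    tau d n hζ (pauliZ d n ζ r) = Multiplicative.ofAdd (Pi.single r 1, 0) :=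
  tau_eq d n hζ _ _ (Subgroup.subset_closure (Or.inl (Or.inl ⟨r, rfl⟩)))

lemma tau_pauliX (d n : ℕ) [NeZero d] {ζ : ℂˣ} (hζ : IsPrimitiveRoot ζ (dbar d)) (r : Fin n) :
    tau d n hζ (pauliX d n ζ r) = Multiplicative.ofAdd (0, Pi.single r 1) :=
  tau_eq d n hζ _ _ (Subgroup.subset_closure (Or.inl (Or.inr ⟨r, rfl⟩)))

lemma tau_pauliZeta (d n : ℕ) [NeZero d] {ζ : ℂˣ} (hζ : IsPrimitiveRoot ζ (dbar d)) :
    tau d n hζ (pauliZeta d n ζ) = 1 :=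
  tau_eq d n hζ _ _ (Subgroup.subset_closure (Or.inr rfl))

/-- The image `τ(H)` as a subgroup (equivalently, a `ℤ/d`-submodule). -/
def tauImage {d n : ℕ} [NeZero d] {ζ : ℂˣ} (hζ : IsPrimitiveRoot ζ (dbar d))
    (H : Subgroup (pauli d n ζ)) : AddSubgroup (PhaseSpace d n) :=
  Subgroup.toAddSubgroup' (H.map (tau d n hζ))

/-- The orthogonal `N^⊥` with respect to the symplectic form. -/
def perp {d n : ℕ} (N : AddSubgroup (PhaseSpace d n)) : AddSubgroup (PhaseSpace d n) where
  carrier := {m | ∀ p ∈ N, sympForm m p = 0}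
  zero_mem' := fun p _ => by simp [sympForm]
  add_mem' := fun {a b} ha hb p hp => by
    have : sympForm (a + b) p = sympForm a p + sympForm b p := by
      simp only [sympForm, ← Finset.sum_add_distrib, Prod.fst_add, Prod.snd_add, Pi.add_apply]
      exact Finset.sum_congr rfl fun _ _ => by ring
    rw [this, ha p hp, hb p hp, add_zero]
  neg_mem' := fun {a} ha p hp => by
    have : sympForm (-a) p = -sympForm a p := by
      simp only [sympForm, ← Finset.sum_neg_distrib, Prod.fst_neg, Prod.snd_neg, Pi.neg_apply]
      exact Finset.sum_congr rfl fun _ _ => by ring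
    rw [this, ha p hp, neg_zero]

/-- The form of the elementary symplectic module `S_c = ℤ/c ⊕ ℤ/c` for a divisor `c` of `d`:
the alternating `ℤ/d`-valued form with `φ((1, 0), (0, 1)) = d / c`. -/
def elemForm (d c : ℕ) (p q : ZMod c × ZMod c) : ZMod d :=
  ((d / c : ℕ) : ZMod d) * (p.1 * q.2 - p.2 * q.1).cast

/-- The form of the orthogonal direct sum `S_(c_1) ⊕ ⋯ ⊕ S_(c_k) ⊕ S_d^{⊕ l}`. -/
def sumForm (d : ℕ) {k l : ℕ} (c : Fin k → ℕ)
    (p q : (∀ r, ZMod (c r) × ZMod (c r)) × (Fin l → ZMod d × ZMod d)) : ZMod d :=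
  ∑ r, elemForm d (c r) (p.1 r) (q.1 r) + ∑ s, elemForm d d (p.2 s) (q.2 s)

/-! ### Twisted free subgroups -/

/-- `B` is a symplectic basis `(e_1, …, e_n, f_1, …, f_n)` of the symplectic module. -/
def IsSymplecticBasis {d n : ℕ}
    (B : Module.Basis (Fin n ⊕ Fin n) (ZMod d) (PhaseSpace d n)) : Prop :=
  ∀ i j : Fin n,
    sympForm (B (Sum.inl i)) (B (Sum.inl j)) = 0 ∧
    sympForm (B (Sum.inr i)) (B (Sum.inr j)) = 0 ∧
    sympForm (B (Sum.inl i)) (B (Sum.inr j)) = if i = j then 1 else 0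

/-- `H` is the twisted free subgroup
`⟨Z'_1^(a_1), …, Z'_k^(a_k), X'_1^(b_1), …, X'_k^(b_k)⟩`, with `d ∣ a_r b_r`, for some symplectic
basis and some lifts `Z'_1, …, Z'_n, X'_1, …, X'_n` of it to the Pauli group that satisfy the
relations of the standard generators.  (For lifts of a symplectic basis the commutation relations
hold automatically, so that only `Z'_r^d = X'_r^d = 1` has to be required.) -/
def IsTwistedFree {d n k : ℕ} [NeZero d] {ζ : ℂˣ} (hζ : IsPrimitiveRoot ζ (dbar d)) (hk : k ≤ n)
    (a b : Fin k → ℕ) (H : Subgroup (pauli d n ζ)) : Prop :=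
  (∀ r, 0 < a r ∧ 0 < b r ∧ d ∣ a r * b r) ∧
  ∃ (B : Module.Basis (Fin n ⊕ Fin n) (ZMod d) (PhaseSpace d n)) (Z' X' : Fin n → pauli d n ζ),
    IsSymplecticBasis B ∧
    (∀ i, tau d n hζ (Z' i) = Multiplicative.ofAdd (B (Sum.inl i)) ∧ Z' i ^ d = 1) ∧
    (∀ i, tau d n hζ (X' i) = Multiplicative.ofAdd (B (Sum.inr i)) ∧ X' i ^ d = 1) ∧
    H = Subgroup.closure
      (Set.range (fun r : Fin k => Z' (Fin.castLE hk r) ^ a r) ∪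
        Set.range (fun r : Fin k => X' (Fin.castLE hk r) ^ b r))

/-! ### The `ζ`-product, the quotient `N(H)/H` and the stabiliser subspace -/

/-- The relations of the `ζ`-product: the distinguished elements `z i` of the groups `G i` are all
identified with the distinguished element `w` of `P`. -/
abbrev zetaRel {ι : Type*} [DecidableEq ι] {G : ι → Type*} [∀ i, Group (G i)] {P : Type*}
    [Group P] (z : ∀ i, G i) (w : P) : Subgroup ((∀ i, G i) × P) :=
  Subgroup.normalClosure (Set.range fun i => (Pi.mulSingle i (z i), w⁻¹))

/-- The `ζ`-product `G_1 ×_ζ ⋯ ×_ζ G_k ×_ζ P`. -/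
abbrev ZetaProd {ι : Type*} [DecidableEq ι] {G : ι → Type*} [∀ i, Group (G i)] {P : Type*}
    [Group P] (z : ∀ i, G i) (w : P) : Type _ :=
  ((∀ i, G i) × P) ⧸ zetaRel z w

/-- The group `P_1^{(c_1,ζ)} ×_ζ ⋯ ×_ζ P_1^{(c_k,ζ)} ×_ζ P_l`. -/
abbrev PauliProd (d l : ℕ) (ζ : ℂˣ) {k : ℕ} (c : Fin k → ℕ) : Type :=
  ZetaProd (G := fun r => pauliOneExt d (c r) ζ) (fun r => pauliOneExtZeta d (c r) ζ)
    (pauliZeta d l ζ)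

/-- The quotient `N(H)/H`, where `N(H)` is the normaliser of `H`. -/
abbrev NormQuot {G : Type*} [Group G] (H : Subgroup G) : Type _ :=
  Subgroup.normalizer (H : Set G) ⧸ H.subgroupOf (Subgroup.normalizer (H : Set G))

/-- The Hermitian space `(ℂ^d)^{⊗ n}`. -/
abbrev QuditSpace (d n : ℕ) : Type := EuclideanSpace ℂ (Fin n → Fin d)

/-- The Hermitian space `ℂ^(c_1) ⊗ ⋯ ⊗ ℂ^(c_k) ⊗ (ℂ^d)^{⊗ l}`. -/
abbrev MixedSpace (d l : ℕ) {k : ℕ} (c : Fin k → ℕ) : Type :=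
  EuclideanSpace ℂ ((∀ r, Fin (c r)) × (Fin l → Fin d))

/-- The operator `g_1 ⊗ ⋯ ⊗ g_k ⊗ h` on `ℂ^(c_1) ⊗ ⋯ ⊗ ℂ^(c_k) ⊗ (ℂ^d)^{⊗ l}`. -/
def mixedAct {d l k : ℕ} {ζ : ℂˣ} {c : Fin k → ℕ} (g : ∀ r, pauliOneExt d (c r) ζ)
    (h : pauli d l ζ) : MixedSpace d l c →ₗ[ℂ] MixedSpace d l c :=
  Matrix.toEuclideanLin
    (Matrix.kroneckerMap (· * ·) (tensorGL c fun r => (g r).1).val h.1.val)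

/-- The action of the Pauli group on `(ℂ^d)^{⊗ n}`. -/
def pauliAct {d n : ℕ} {ζ : ℂˣ} (g : pauli d n ζ) : QuditSpace d n →ₗ[ℂ] QuditSpace d n :=
  Matrix.toEuclideanLin g.1.val

/-- The stabiliser subspace `V^H` of `V = (ℂ^d)^{⊗ n}`. -/
def stabSpace {d n : ℕ} {ζ : ℂˣ} (H : Subgroup (pauli d n ζ)) : Submodule ℂ (QuditSpace d n) where
  carrier := {v | ∀ h ∈ H, pauliAct h v = v}
  zero_mem' := fun h _ => map_zero _
  add_mem' := fun hu hv h hh => by rw [map_add, hu h hh, hv h hh]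
  smul_mem' := fun t v hv h hh => by rw [map_smul, hv h hh]

end QuditPauli

end

open QuditPauli

/-! Everything rests on three facts about the Pauli group: two elements commute up to `ξ ^ φ(τ g, τ
h)` (`pauli_mul_eq`); the kernel of `τ` consists of powers of `ζ` (`eq_zpow_pauliZeta_of_tau`);
every element outside that kernel has trace zero (`trace_eq_zero_of_tau`).

The unused qudits are put on the same footing as the others by adding the trivial generators `Z_i ^
d = X_i ^ d = 1`. Then `H` is generated by `Z_i ^ (C_i q_i)` and `X_i ^ (C_i q'_i)` with `C_i q_i
q'_i = d`; for the first `k` indices `C = c`, `q = d / b`, `q' = d / a`, for the others `C = d` and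
`q = q' = 1`. Such an `H` is abelian and `τ` is injective on it (`eq_one_of_tau`), so a commutator
lying in `H` is trivial and the normaliser is the preimage of `τ(H)^⊥` (`mem_normalizer_iff`). In
coordinates `τ(H)^⊥` consists of the multiples of `q_i`, `q'_i`, and `τ(H)` of the multiples of `C_i
q_i`, `C_i q'_i`. Dividing by `q_i` and `q'_i` identifies the quotient with the sum of the
`(ℤ/C_i)²`, and the form is multiplied by `q_i q'_i = d / C_i`.

For the stabiliser space, choose a unit vector `w` fixed by the larger isotropic group generated by
the `Z_i ^ q_i` and `X_i ^ (C_i q'_i)`. Its translates by products of powers of the `X_i ^ q'_i` lie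
in `V^H` and are separated by their `Z_i ^ q_i`-eigenvalues, hence orthonormal. The trace of the
averaging projection gives `dim V^H = d^n / |H|`, so they form a basis (`exists_stabSpace_basis`).
On it `X_i ^ q'_i` acts as the shift and `Z_i ^ q_i` as the clock of dimension `C_i`; this is the
isometry `U`.

The group isomorphism is not defined by a formula. The pairs of operators that correspond under `U`
form a subgroup of `N(H)` times the product of the Pauli groups. It projects onto both sides by
checking generators. Its left kernel is `H` (`mem_of_fixes`, again by traces), and its right kernel
consists of the `ζ`-relations, because a tensor product of monomial matrices is the identity only if
every factor is a scalar power of `ζ` (`mem_zetaRel_of_mixedMat`). Goursat's lemma turns this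
relation into the isomorphism, and membership in the relation is the intertwining property. -/

namespace QuditPauli

/-! ### Matrices that send a basis vector to a multiple of a basis vector -/

section SendsBasis

variable {J : Type*} [DecidableEq J]

/-- `A v_q = t v_p`. -/
def SendsBasis (A : Matrix J J ℂ) (q p : J) (t : ℂ) : Prop :=
  ∀ p', A p' q = if p' = p then t else 0

lemma SendsBasis.one (q : J) : SendsBasis (1 : Matrix J J ℂ) q q 1 := fun p' => by
  rw [Matrix.one_apply]

lemma SendsBasis.kronecker {I : Type*} [DecidableEq I] {A : Matrix I I ℂ}
    {B : Matrix J J ℂ} {q p : I} {q' p' : J} {s t : ℂ} (hA : SendsBasis A q p s)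
    (hB : SendsBasis B q' p' t) :
    SendsBasis (Matrix.kroneckerMap (· * ·) A B) (q, q') (p, p') (s * t) := by
  rintro ⟨x, y⟩
  change A x q * B y q' = _
  rw [hA, hB]
  by_cases hx : x = p <;> by_cases hy : y = p' <;> simp [hx, hy]

variable [Fintype J]

lemma SendsBasis.mul {A B : Matrix J J ℂ} {q p r : J} {s t : ℂ} (hA : SendsBasis A p r s)
    (hB : SendsBasis B q p t) : SendsBasis (A * B) q r (t * s) := fun p' => by
  rw [Matrix.mul_apply, Finset.sum_eq_single p]
  · rw [hB p, if_pos rfl, hA p']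
    split_ifs <;> ring
  · intro i _ hi
    rw [hB i, if_neg hi, mul_zero]
  · simp

lemma SendsBasis.toEuclideanLin {A : Matrix J J ℂ} {q p : J} {t : ℂ} (h : SendsBasis A q p t) :
    Matrix.toEuclideanLin A (EuclideanSpace.single q 1) = t • EuclideanSpace.single p 1 := by
  ext p'
  rw [Matrix.toLpLin_apply]
  simp [h p']

lemma SendsBasis.scalar (ω : ℂˣ) (q : J) :
    SendsBasis (scalarGL J ω).val q q ω := fun p' => by
  change Matrix.scalar J (ω : ℂ) p' q = _
  rw [Matrix.scalar_apply, Matrix.diagonal_apply]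

lemma SendsBasis.shiftX (m : ℕ) (q : Fin m) :
    SendsBasis (shiftX m).val q (finRotate m q) 1 := fun _ => rfl

lemma SendsBasis.shiftX_inv (m : ℕ) (q : Fin m) :
    SendsBasis (QuditPauli.shiftX m)⁻¹.val q ((finRotate m).symm q) 1 := fun p' => by
  change (if finRotate m p' = q then (1 : ℂ) else 0) = _
  simp only [Equiv.eq_symm_apply]

lemma SendsBasis.clockZ (m : ℕ) (ω : ℂˣ) (q : Fin m) :
    SendsBasis (clockZ m ω).val q q ((ω ^ (q : ℕ) : ℂˣ) : ℂ) := fun p' => by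
  change Matrix.diagonal _ p' q = _
  rw [Matrix.diagonal_apply]
  by_cases h : p' = q <;> simp [h]

lemma SendsBasis.clockZ_inv (m : ℕ) (ω : ℂˣ) (q : Fin m) :
    SendsBasis (QuditPauli.clockZ m ω)⁻¹.val q q (((ω ^ (q : ℕ))⁻¹ : ℂˣ) : ℂ) := fun p' => by
  change Matrix.diagonal _ p' q = _
  rw [Matrix.diagonal_apply]
  by_cases h : p' = q <;> simp [h]

lemma SendsBasis.tensor {ι : Type*} [Fintype ι] [DecidableEq ι] {m : ι → ℕ}
    {A : ∀ i, Matrix (Fin (m i)) (Fin (m i)) ℂ} {q p : ∀ i, Fin (m i)} {t : ι → ℂ}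
    (h : ∀ i, SendsBasis (A i) (q i) (p i) (t i)) :
    SendsBasis (tensorMat m A) q p (∏ i, t i) := fun p' => by
  change ∏ i, A i (p' i) (q i) = _
  by_cases hp : p' = p
  · subst hp
    rw [if_pos rfl]
    exact Finset.prod_congr rfl fun i _ => by rw [h i, if_pos rfl]
  · obtain ⟨i, hi⟩ := Function.ne_iff.mp hp
    rw [if_neg hp]
    exact Finset.prod_eq_zero (Finset.mem_univ i) (by rw [h i, if_neg hi])

lemma SendsBasis.tensor_mulSingle {ι : Type*} [Fintype ι] [DecidableEq ι] {m : ι → ℕ} (r : ι)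
    {A : GL (Fin (m r)) ℂ} {q : ∀ i, Fin (m i)} {p : Fin (m r)} {t : ℂ}
    (h : SendsBasis A.val (q r) p t) :
    SendsBasis (tensorGL m (Pi.mulSingle r A)).val q (Function.update q r p) t := by
  have h1 : ∀ i, SendsBasis ((Pi.mulSingle (M := fun i => GL (Fin (m i)) ℂ) r A) i).val (q i)
      (Function.update q r p i) (if i = r then t else 1) := by
    intro i
    by_cases hi : i = r
    · subst hi
      simpa using h
    · rw [Pi.mulSingle_eq_of_ne hi, Function.update_of_ne hi, if_neg hi]
      exact SendsBasis.one _
  have h2 := SendsBasis.tensor h1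
  rwa [Finset.prod_ite_eq' Finset.univ r (fun _ => t), if_pos (Finset.mem_univ r)] at h2

end SendsBasis

/-! ### Monomial matrices -/

section Monomial

variable {J : Type*} [DecidableEq J]

/-- Every column of `A` has exactly one nonzero entry, and this is a power of `ζ`. -/
def IsMonomial (ζ : ℂˣ) (A : Matrix J J ℂ) : Prop :=
  ∀ q, ∃ p, ∃ e : ℤ, SendsBasis A q p ((ζ ^ e : ℂˣ) : ℂ)

lemma IsMonomial.one (ζ : ℂˣ) : IsMonomial ζ (1 : Matrix J J ℂ) := fun q =>
  ⟨q, 0, by simpa using SendsBasis.one q⟩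

/-- A monomial matrix with nonzero diagonal entries is diagonal with entries in `⟨ζ⟩`. -/
lemma IsMonomial.sendsBasis_self {ζ : ℂˣ} {A : Matrix J J ℂ} (hA : IsMonomial ζ A) {q : J}
    (h : A q q ≠ 0) : ∃ e : ℤ, SendsBasis A q q ((ζ ^ e : ℂˣ) : ℂ) := by
  obtain ⟨p, e, hp⟩ := hA q
  have : q = p := by
    by_contra hne
    exact h (by rw [hp, if_neg hne])
  subst this
  exact ⟨e, hp⟩

variable [Fintype J]

lemma IsMonomial.mul {ζ : ℂˣ} {A B : Matrix J J ℂ} (hA : IsMonomial ζ A) (hB : IsMonomial ζ B) :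
    IsMonomial ζ (A * B) := fun q => by
  obtain ⟨p, e, h⟩ := hB q
  obtain ⟨r, f, h'⟩ := hA p
  exact ⟨r, e + f, by rw [_root_.zpow_add, Units.val_mul]; exact h'.mul h⟩

/-- The definition of monomial only speaks of columns and gives no direct access to inverses, so the
inverses of the generators are part of the hypothesis. -/
lemma isMonomial_of_mem_closure {ζ : ℂˣ} {S : Set (GL J ℂ)}
    (hS : ∀ A ∈ S, IsMonomial ζ A.val ∧ IsMonomial ζ A⁻¹.val) {A : GL J ℂ}
    (hA : A ∈ Subgroup.closure S) : IsMonomial ζ A.val := by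
  induction hA using Subgroup.closure_induction'' with
  | mem x hx => exact (hS x hx).1
  | inv_mem x hx => exact (hS x hx).2
  | one => exact IsMonomial.one ζ
  | mul x y _ _ hx hy => exact hx.mul hy

lemma IsMonomial.scalar (ζ : ℂˣ) (e : ℤ) : IsMonomial ζ (scalarGL J (ζ ^ e)).val := fun q =>
  ⟨q, e, SendsBasis.scalar _ q⟩

lemma IsMonomial.scalar' (ζ : ℂˣ) : IsMonomial ζ (scalarGL J ζ).val ∧
    IsMonomial ζ (scalarGL J ζ)⁻¹.val := by
  rw [← map_inv]
  exact ⟨by simpa using IsMonomial.scalar (J := J) ζ 1,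
    by simpa using IsMonomial.scalar (J := J) ζ (-1)⟩

lemma IsMonomial.shiftX (ζ : ℂˣ) (m : ℕ) : IsMonomial ζ (shiftX m).val ∧
    IsMonomial ζ (QuditPauli.shiftX m)⁻¹.val :=
  ⟨fun q => ⟨_, 0, by simpa using SendsBasis.shiftX m q⟩,
    fun q => ⟨_, 0, by simpa using SendsBasis.shiftX_inv m q⟩⟩

lemma IsMonomial.clockZ (ζ : ℂˣ) (e : ℤ) (m : ℕ) : IsMonomial ζ (clockZ m (ζ ^ e)).val ∧
    IsMonomial ζ (QuditPauli.clockZ m (ζ ^ e))⁻¹.val :=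
  ⟨fun q => ⟨q, e * q, by
    rw [_root_.zpow_mul, zpow_natCast]; exact SendsBasis.clockZ m (ζ ^ e) q⟩,
    fun q => ⟨q, -(e * q), by
      rw [_root_.zpow_neg, _root_.zpow_mul, zpow_natCast]; exact SendsBasis.clockZ_inv m (ζ ^ e) q⟩⟩

lemma IsMonomial.tensor {ζ : ℂˣ} {ι : Type*} [Fintype ι] [DecidableEq ι] {m : ι → ℕ}
    {A : ∀ i, Matrix (Fin (m i)) (Fin (m i)) ℂ} (h : ∀ i, IsMonomial ζ (A i)) :
    IsMonomial ζ (tensorMat m A) := fun q => by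
  choose p e hp using fun i => h i (q i)
  refine ⟨p, ∑ i, e i, ?_⟩
  have := SendsBasis.tensor hp
  have h2 : ζ ^ (∑ i, e i) = ∏ i, ζ ^ e i :=
    map_sum (zpowersHom ℂˣ ζ).toAdditiveRight e Finset.univ
  rw [h2, Units.coe_prod]
  exact this

lemma IsMonomial.onQudit {ζ : ℂˣ} {d n : ℕ} (r : Fin n) {A : GL (Fin d) ℂ}
    (h : IsMonomial ζ A.val) : IsMonomial ζ (onQudit d n r A).val := by
  refine IsMonomial.tensor
    (A := fun i => ((Pi.mulSingle (M := fun _ : Fin n => GL (Fin d) ℂ) r A) i).val) fun i => ?_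
  by_cases hi : i = r
  · subst hi; simpa using h
  · rw [Pi.mulSingle_eq_of_ne hi]; exact IsMonomial.one ζ

/-- This control of the entries is what forces a scalar operator in the group to be a power of `ζ`
and not an arbitrary complex number. -/
lemma isMonomial_pauli {d n : ℕ} {ζ : ℂˣ} {A : GL (Fin n → Fin d) ℂ} (hA : A ∈ pauli d n ζ) :
    IsMonomial ζ A.val := by
  refine isMonomial_of_mem_closure ?_ hA
  rintro _ ((⟨r, rfl⟩ | ⟨r, rfl⟩) | rfl)
  · have := IsMonomial.clockZ ζ 2 d
    rw [← map_inv]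
    exact ⟨this.1.onQudit r, this.2.onQudit r⟩
  · have := IsMonomial.shiftX ζ d
    rw [← map_inv]
    exact ⟨this.1.onQudit r, this.2.onQudit r⟩
  · exact IsMonomial.scalar' ζ

lemma isMonomial_pauliOneExt {d c : ℕ} {ζ : ℂˣ} {A : GL (Fin c) ℂ} (hA : A ∈ pauliOneExt d c ζ) :
    IsMonomial ζ A.val := by
  rw [pauliOneExt, pauliOne, Subgroup.zpowers_eq_closure, ← Subgroup.closure_union] at hA
  refine isMonomial_of_mem_closure ?_ hA
  rintro _ ((rfl | rfl | rfl) | rfl)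
  · exact IsMonomial.shiftX ζ c
  · have := IsMonomial.clockZ ζ ((dbar d / dbar c * 2 : ℕ) : ℤ) c
    rwa [zpow_natCast, pow_mul] at this
  · have h1 := IsMonomial.scalar (J := Fin c) ζ ((dbar d / dbar c : ℕ) : ℤ)
    have h2 := IsMonomial.scalar (J := Fin c) ζ (-((dbar d / dbar c : ℕ) : ℤ))
    rw [_root_.zpow_neg, map_inv] at h2
    rw [zpow_natCast] at h1 h2
    exact ⟨h1, h2⟩
  · exact IsMonomial.scalar' ζ

lemma eq_scalarGL_of_sendsBasis {A : GL J ℂ} {ω : ℂˣ} (h : ∀ q, SendsBasis A.val q q ω) :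
    A = scalarGL J ω := by
  ext p q
  rw [h q p, SendsBasis.scalar ω q p]

end Monomial

/-! ### Unitary matrices in the general linear group -/

section Unitary

/-- The invertible matrices whose inverse is the conjugate transpose. -/
def unitaryGL (J : Type*) [Fintype J] [DecidableEq J] : Subgroup (GL J ℂ) where
  carrier := {A | A⁻¹.val = A.valᴴ}
  one_mem' := by simp
  mul_mem' := fun {A B} hA hB => by
    simp only [Set.mem_ofPred_eq] at *
    rw [_root_.mul_inv_rev, Units.val_mul, Units.val_mul, Matrix.conjTranspose_mul, hA, hB]
  inv_mem' := fun {A} hA => by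
    simp only [Set.mem_ofPred_eq] at *
    rw [hA, inv_inv, Matrix.conjTranspose_conjTranspose]

lemma shiftX_mem_unitaryGL (m : ℕ) : shiftX m ∈ unitaryGL (Fin m) := by
  change (shiftX m)⁻¹.val = (shiftX m).valᴴ
  ext p q
  change (if finRotate m p = q then (1 : ℂ) else 0) = star (if q = finRotate m p then (1 : ℂ) else 0)
  by_cases h : q = finRotate m p
  · rw [if_pos h, if_pos h.symm, star_one]
  · rw [if_neg h, if_neg (Ne.symm h), star_zero]

lemma star_eq_inv_of_norm {ω : ℂˣ} (h : ‖(ω : ℂ)‖ = 1) : star (ω : ℂ) = ((ω⁻¹ : ℂˣ) : ℂ) := by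
  rw [Units.val_inv_eq_inv_val, Complex.inv_eq_conj h]; rfl

lemma clockZ_mem_unitaryGL (m : ℕ) {ω : ℂˣ} (h : ‖(ω : ℂ)‖ = 1) :
    clockZ m ω ∈ unitaryGL (Fin m) := by
  change Matrix.diagonal _ = (Matrix.diagonal _)ᴴ
  rw [Matrix.diagonal_conjTranspose]
  congr 1
  ext j
  exact (star_eq_inv_of_norm (by simp [h])).symm

lemma scalarGL_mem_unitaryGL {J : Type*} [Fintype J] [DecidableEq J] {ω : ℂˣ}
    (h : ‖(ω : ℂ)‖ = 1) : scalarGL J ω ∈ unitaryGL J := by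
  change (scalarGL J ω)⁻¹.val = (scalarGL J ω).valᴴ
  rw [← map_inv]
  change Matrix.diagonal _ = (Matrix.diagonal _)ᴴ
  rw [Matrix.diagonal_conjTranspose]
  congr 1
  ext j
  exact (star_eq_inv_of_norm h).symm

lemma onQudit_mem_unitaryGL {d n : ℕ} (r : Fin n) {A : GL (Fin d) ℂ}
    (h : A ∈ unitaryGL (Fin d)) : onQudit d n r A ∈ unitaryGL (Fin n → Fin d) := by
  change (onQudit d n r A)⁻¹.val = (onQudit d n r A).valᴴ
  rw [← map_inv]
  ext p q
  change ∏ i, ((Pi.mulSingle (M := fun _ : Fin n => GL (Fin d) ℂ) r A⁻¹) i).val (p i) (q i) =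
    star (∏ i, ((Pi.mulSingle (M := fun _ : Fin n => GL (Fin d) ℂ) r A) i).val (q i) (p i))
  rw [star_prod]
  refine Finset.prod_congr rfl fun i _ => ?_
  by_cases hi : i = r
  · subst hi
    rw [Pi.mulSingle_eq_same, Pi.mulSingle_eq_same, show A⁻¹.val = A.valᴴ from h]
    rfl
  · rw [Pi.mulSingle_eq_of_ne hi, Pi.mulSingle_eq_of_ne hi, Units.val_one, Matrix.one_apply,
      Matrix.one_apply]
    by_cases h : p i = q i
    · rw [if_pos h, if_pos h.symm, star_one]
    · rw [if_neg h, if_neg (Ne.symm h), star_zero]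

lemma dbar_ne_zero (d : ℕ) [NeZero d] : dbar d ≠ 0 := by
  have := NeZero.ne d
  unfold dbar
  split_ifs <;> omega

lemma pauli_le_unitaryGL {d n : ℕ} [NeZero d] {ζ : ℂˣ} (hζ : IsPrimitiveRoot ζ (dbar d)) :
    pauli d n ζ ≤ unitaryGL (Fin n → Fin d) := by
  have hn : ‖(ζ : ℂ)‖ = 1 :=
    (IsPrimitiveRoot.coe_units_iff.mpr hζ).norm'_eq_one (dbar_ne_zero d)
  rw [pauli, Subgroup.closure_le]
  rintro _ ((⟨r, rfl⟩ | ⟨r, rfl⟩) | rfl)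
  · exact onQudit_mem_unitaryGL r (clockZ_mem_unitaryGL d (by simp [hn]))
  · exact onQudit_mem_unitaryGL r (shiftX_mem_unitaryGL d)
  · exact scalarGL_mem_unitaryGL hn

end Unitary

/-! ### Generators of the extended one-qudit Pauli group -/

lemma clockZ_pow (m : ℕ) (ω : ℂˣ) (e : ℕ) : clockZ m ω ^ e = clockZ m (ω ^ e) := by
  induction e with
  | zero =>
    ext1
    change (1 : Matrix (Fin m) (Fin m) ℂ) = Matrix.diagonal _
    simp
  | succ e ih =>
    rw [pow_succ, ih]
    ext1
    change Matrix.diagonal _ * Matrix.diagonal _ = Matrix.diagonal _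
    rw [Matrix.diagonal_mul_diagonal]
    congr 1
    ext j
    rw [← Units.val_mul, ← mul_pow, ← pow_succ]

/-- The root of unity that occurs naturally on the stabiliser space is `ξ ^ (d / c)`, whereas the
group is formed with `(ζ ^ (d̄ / c̄)) ^ 2`. Each is a power of the other, so both clock operators
generate the same group; the two roots can differ only for `c` odd and `d` even. -/
lemma pauliOneExt_eq_closure {d c : ℕ} [NeZero d] {ζ : ℂˣ} (hζ : IsPrimitiveRoot ζ (dbar d))
    (hc : c ∣ d) : pauliOneExt d c ζ =
      Subgroup.closure {shiftX c, clockZ c ((ζ ^ 2) ^ (d / c)), scalarGL (Fin c) ζ} := by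
  have hd := NeZero.ne d
  obtain ⟨e, rfl⟩ := hc
  have hc0 : 0 < c := Nat.pos_of_ne_zero (by rintro rfl; simp at hd)
  have he0 : 0 < e := Nat.pos_of_ne_zero (by rintro rfl; simp at hd)
  rw [Nat.mul_div_cancel_left e hc0]
  have hξ := (isPrimitiveRoot_sq hζ).pow_eq_one
  rw [pauliOneExt, pauliOne, Subgroup.zpowers_eq_closure, ← Subgroup.closure_union]
  have hclock : ∃ s t : ℕ, (ζ ^ (dbar (c * e) / dbar c)) ^ 2 = ((ζ ^ 2) ^ e) ^ s ∧
      (ζ ^ 2) ^ e = ((ζ ^ (dbar (c * e) / dbar c)) ^ 2) ^ t := by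
    rcases Nat.even_or_odd c with h1 | h1
    · have h2 : ¬ Odd (c * e) := by simp [Nat.not_odd_iff_even.mpr h1, Nat.odd_mul]
      have h3 : dbar (c * e) / dbar c = e := by
        rw [dbar, dbar, if_neg h2, if_neg (Nat.not_odd_iff_even.mpr h1), ← mul_assoc,
          Nat.mul_div_cancel_left e (by omega)]
      rw [h3]
      exact ⟨1, 1, by rw [pow_right_comm, pow_one], by rw [pow_right_comm, pow_one]⟩
    · by_cases h2 : Odd (c * e)
      · have h3 : dbar (c * e) / dbar c = e := by
          rw [dbar, dbar, if_pos h2, if_pos h1, Nat.mul_div_cancel_left e (by omega)]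
        rw [h3]
        exact ⟨1, 1, by rw [pow_right_comm, pow_one], by rw [pow_right_comm, pow_one]⟩
      · have h3 : dbar (c * e) / dbar c = 2 * e := by
          rw [dbar, dbar, if_neg h2, if_pos h1, show 2 * (c * e) = c * (2 * e) by ring,
            Nat.mul_div_cancel_left _ (by omega)]
        obtain ⟨f, hf⟩ := h1
        rw [h3]
        -- Here `c = 2 f + 1`, and the two roots are `ξ ^ (2 e)` and `ξ ^ e`. Squaring is inverted
        -- by the exponent `f + 1`, since `2 e (f + 1) = c e + e` and `ξ ^ (c e) = 1`.
        refine ⟨2, f + 1, by rw [← pow_mul, ← pow_mul, ← pow_mul]; congr 1; ring, ?_⟩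
        have : ((ζ ^ (2 * e)) ^ 2) ^ (f + 1) = (ζ ^ 2) ^ (c * e) * (ζ ^ 2) ^ e := by
          rw [← pow_mul, ← pow_mul, ← pow_mul, ← pow_mul, ← pow_add]
          congr 1
          rw [hf]; ring
        rw [this, hξ, one_mul]
  obtain ⟨s, t, hs, ht⟩ := hclock
  apply le_antisymm
  · rw [Subgroup.closure_le]
    rintro _ ((rfl | rfl | rfl) | rfl)
    · exact Subgroup.subset_closure (by simp)
    · rw [show clockZ c ((ζ ^ (dbar (c * e) / dbar c)) ^ 2) = clockZ c ((ζ ^ 2) ^ e) ^ s by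
        rw [clockZ_pow, hs]]
      exact pow_mem (Subgroup.subset_closure (by simp)) _
    · rw [map_pow]
      exact pow_mem (Subgroup.subset_closure (by simp)) _
    · exact Subgroup.subset_closure (by simp)
  · rw [Subgroup.closure_le]
    rintro _ (rfl | rfl | rfl)
    · exact Subgroup.subset_closure (by simp)
    · rw [show clockZ c ((ζ ^ 2) ^ e) = clockZ c ((ζ ^ (dbar (c * e) / dbar c)) ^ 2) ^ t by
        rw [clockZ_pow, ← ht]]
      exact pow_mem (Subgroup.subset_closure (by simp)) _
    · exact Subgroup.subset_closure (by simp)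

/-! ### The symplectic form and the commutation relations -/

section Commutation

variable {d n : ℕ}

lemma sympForm_swap (p q : PhaseSpace d n) : sympForm p q = -sympForm q p := by
  rw [sympForm, sympForm, ← Finset.sum_neg_distrib]
  exact Finset.sum_congr rfl fun _ _ => by ring

/-- The linear form `φ(·, q)`. -/
def sympFormLeft (q : PhaseSpace d n) : PhaseSpace d n →ₗ[ZMod d] ZMod d where
  toFun p := sympForm p q
  map_add' p p' := by
    simp only [sympForm, ← Finset.sum_add_distrib, Prod.fst_add, Prod.snd_add, Pi.add_apply]
    exact Finset.sum_congr rfl fun _ _ => by ring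
  map_smul' t p := by
    simp only [sympForm, Finset.mul_sum, Prod.smul_fst, Prod.smul_snd, Pi.smul_apply, smul_eq_mul,
      RingHom.id_apply]
    exact Finset.sum_congr rfl fun _ _ => by ring

/-- The linear form `φ(p, ·)`. -/
def sympFormRight (p : PhaseSpace d n) : PhaseSpace d n →ₗ[ZMod d] ZMod d where
  toFun q := sympForm p q
  map_add' q q' := by
    rw [sympForm_swap, sympForm_swap p q, sympForm_swap p q', ← neg_add]
    exact congrArg _ (map_add (sympFormLeft p) q q')
  map_smul' t q := by
    rw [sympForm_swap, sympForm_swap p q, RingHom.id_apply, smul_neg]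
    exact congrArg _ (map_smul (sympFormLeft p) t q)

lemma sympForm_eq_left (p q : PhaseSpace d n) : sympForm p q = sympFormLeft q p := rfl

lemma sympForm_eq_right (p q : PhaseSpace d n) : sympForm p q = sympFormRight p q := rfl

@[simp] lemma sympForm_z_left (r : Fin n) (m : PhaseSpace d n) :
    sympForm (Pi.single r 1, 0) m = m.2 r := by
  simp [sympForm, Pi.single_apply]

@[simp] lemma sympForm_x_left (r : Fin n) (m : PhaseSpace d n) :
    sympForm (0, Pi.single r 1) m = -m.1 r := by
  simp [sympForm, Pi.single_apply]

@[simp] lemma sympForm_z_right (r : Fin n) (m : PhaseSpace d n) :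
    sympForm m (Pi.single r 1, 0) = -m.2 r := by
  rw [sympForm_swap, sympForm_z_left]

@[simp] lemma sympForm_x_right (r : Fin n) (m : PhaseSpace d n) :
    sympForm m (0, Pi.single r 1) = m.1 r := by
  rw [sympForm_swap, sympForm_x_left, neg_neg]

lemma eq_scalar_mul_symm {J : Type*} [Fintype J] [DecidableEq J] {A B : GL J ℂ}
    {ψ : AddChar (ZMod d) ℂˣ} {t : ZMod d} (h : A * B = scalarGL J (ψ t) * (B * A)) :
    B * A = scalarGL J (ψ (-t)) * (A * B) := by
  rw [h, ← mul_assoc, ← map_mul, ← AddChar.map_add_eq_mul, neg_add_cancel,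
    AddChar.map_zero_eq_one, map_one, one_mul]

variable [NeZero d] {ζ : ℂˣ}

/-- The additive character `t ↦ ξ^t` of `ℤ/d`. -/
def phase (hζ : IsPrimitiveRoot ζ (dbar d)) : AddChar (ZMod d) ℂˣ :=
  AddChar.zmodChar d (isPrimitiveRoot_sq hζ).pow_eq_one

lemma phase_eq_one_iff (hζ : IsPrimitiveRoot ζ (dbar d)) {t : ZMod d} :
    phase hζ t = 1 ↔ t = 0 := by
  refine ⟨fun h => ?_, fun h => by rw [h]; exact AddChar.map_zero_eq_one _⟩
  have h' : (ζ ^ 2) ^ t.val = 1 := h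
  rw [(isPrimitiveRoot_sq hζ).pow_eq_one_iff_dvd] at h'
  exact (ZMod.val_eq_zero _).mp (Nat.eq_zero_of_dvd_of_lt h' (ZMod.val_lt _))

lemma phase_natCast (hζ : IsPrimitiveRoot ζ (dbar d)) (t : ℕ) :
    phase hζ (t : ZMod d) = (ζ ^ 2) ^ t :=
  AddChar.zmodChar_apply' (isPrimitiveRoot_sq hζ).pow_eq_one t

lemma phase_one (hζ : IsPrimitiveRoot ζ (dbar d)) : phase hζ 1 = ζ ^ 2 := by
  simpa using phase_natCast hζ 1

lemma mem_tauGraph (hζ : IsPrimitiveRoot ζ (dbar d)) (g : pauli d n ζ) :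
    ((g : GL (Fin n → Fin d) ℂ), tau d n hζ g) ∈ tauGraph d n ζ := by
  have h := ((tauGraphEquiv d n hζ).symm g).2
  have h2 : ((tauGraphEquiv d n hζ).symm g).1.1 = (g : GL (Fin n → Fin d) ℂ) :=
    congrArg Subtype.val ((tauGraphEquiv d n hζ).apply_symm_apply g)
  rw [← h2]
  exact h

/-- The commutation factor with a fixed `B` is multiplicative in the other argument, so it is a
character of the phase space as soon as it is so on generators. -/
lemma mul_eq_phase_of_generators (hζ : IsPrimitiveRoot ζ (dbar d)) (B : GL (Fin n → Fin d) ℂ)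
    (m : PhaseSpace d n)
    (hZ : ∀ r, onQudit d n r (clockZ d (ζ ^ 2)) * B =
      scalarGL _ (phase hζ (m.2 r)) * (B * onQudit d n r (clockZ d (ζ ^ 2))))
    (hX : ∀ r, onQudit d n r (shiftX d) * B =
      scalarGL _ (phase hζ (-m.1 r)) * (B * onQudit d n r (shiftX d)))
    (g : pauli d n ζ) : g.1 * B =
      scalarGL _ (phase hζ (sympForm (tau d n hζ g).toAdd m)) * (B * g.1) := by
  refine tauGraph_commute (x := (_, _)) B
    (phaseChar (isPrimitiveRoot_sq hζ).pow_eq_one (sympFormLeft m).toAddMonoidHom)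
    (fun r => ?_) (fun r => ?_) (mem_tauGraph hζ g)
  · rw [hZ, ← sympForm_z_left r m]
    rfl
  · rw [hX, ← sympForm_x_left r m]
    rfl

/-- Elements of the Pauli group commute up to the power of `ξ` given by the symplectic form. -/
lemma pauli_mul_eq (hζ : IsPrimitiveRoot ζ (dbar d)) (g h : pauli d n ζ) :
    g.1 * h.1 =
      scalarGL _ (phase hζ (sympForm (tau d n hζ g).toAdd (tau d n hζ h).toAdd)) * (h.1 * g.1) := by
  have key := clockZ_mul_shiftX (isPrimitiveRoot_sq hζ).pow_eq_one
  have hZX : ∀ r s : Fin n, onQudit d n r (clockZ d (ζ ^ 2)) * onQudit d n s (shiftX d) =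
      scalarGL _ (phase hζ (Pi.single (M := fun _ => ZMod d) s 1 r)) *
        (onQudit d n s (shiftX d) * onQudit d n r (clockZ d (ζ ^ 2))) := by
    intro r s
    by_cases hrs : r = s
    · subst hrs
      rw [Pi.single_eq_same, phase_one, ← map_mul, key, map_mul, map_mul, onQudit_scalarGL]
    · rw [Pi.single_eq_of_ne hrs, AddChar.map_zero_eq_one, map_one, one_mul, onQudit_comm hrs]
  have hself : ∀ (A : GL (Fin d) ℂ) (r s : Fin n),
      onQudit d n r A * onQudit d n s A = onQudit d n s A * onQudit d n r A := by
    intro A r s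
    by_cases hrs : r = s
    · rw [hrs]
    · rw [onQudit_comm hrs]
  -- Extension from generators in one variable at a time: this reduces `g` to a generator, and the
  -- same lemma with that generator as `B` then reduces `h`.
  refine mul_eq_phase_of_generators hζ _ _ (fun r => ?_) (fun r => ?_) g
  · have h1 := mul_eq_phase_of_generators hζ (onQudit d n r (clockZ d (ζ ^ 2)))
      (Pi.single r 1, 0) (fun s => ?_) (fun s => ?_) h
    · rw [sympForm_z_right] at h1
      simpa using eq_scalar_mul_symm h1
    · simp [hself]
    · refine eq_scalar_mul_symm ?_
      rw [hZX r s]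
      simp only [Pi.single_apply, eq_comm]
  · have h1 := mul_eq_phase_of_generators hζ (onQudit d n r (shiftX d))
      (0, Pi.single r 1) (fun s => ?_) (fun s => ?_) h
    · rw [sympForm_x_right] at h1
      exact eq_scalar_mul_symm h1
    · exact hZX s r
    · simp [hself]

lemma pauli_commute (hζ : IsPrimitiveRoot ζ (dbar d)) {g h : pauli d n ζ}
    (hgh : sympForm (tau d n hζ g).toAdd (tau d n hζ h).toAdd = 0) : Commute g h := by
  have := pauli_mul_eq hζ g h
  rw [hgh, AddChar.map_zero_eq_one, map_one, one_mul] at this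
  exact Subtype.ext this

end Commutation

/-! ### The kernel of `τ` and traces -/

section Kernel

variable {d n : ℕ} [NeZero d] {ζ : ℂˣ}

lemma SendsBasis.eq_coeff {J : Type*} [DecidableEq J] {A : Matrix J J ℂ} {q p : J} {s t : ℂ}
    (h : SendsBasis A q p s) (h' : SendsBasis A q p t) : s = t := by
  have := (h p).symm.trans (h' p)
  simpa using this

lemma SendsBasis.shiftX_pow {m : ℕ} [NeZero m] (j : ℕ) (hj : j < m) :
    SendsBasis (QuditPauli.shiftX m ^ j).val 0 ⟨j, hj⟩ 1 := by
  induction j with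
  | zero => exact SendsBasis.one _
  | succ j ih =>
    rw [pow_succ', Units.val_mul]
    have h := (SendsBasis.shiftX m ⟨j, by omega⟩).mul (ih (by omega))
    have h2 : finRotate m ⟨j, by omega⟩ = ⟨j + 1, hj⟩ := by
      rw [finRotate_apply]
      ext
      rw [Fin.val_add]
      have : ((1 : Fin m) : ℕ) = 1 % m := Fin.val_one' m
      rw [this, Nat.add_mod_mod, Nat.mod_eq_of_lt hj]
    rwa [h2, mul_one] at h

lemma onQudit_shiftX_mem (d n : ℕ) (ζ : ℂˣ) (r : Fin n) : onQudit d n r (shiftX d) ∈ pauli d n ζ :=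
  (pauliX d n ζ r).2

/-- The product of the `X_r ^ (q_r)` does this. Transitivity on the basis vectors is what compares
the diagonal entries of an operator that commutes with the whole group. -/
lemma exists_pauli_sendsBasis (ζ : ℂˣ) (q : Fin n → Fin d) :
    ∃ g : pauli d n ζ, SendsBasis g.1.val 0 q 1 := by
  have h : (fun r => shiftX d ^ (q r : ℕ)) ∈ (pauli d n ζ).comap (tensorGL fun _ : Fin n => d) := by
    refine Subgroup.pi_mem_of_mulSingle_mem _ fun r => ?_
    rw [Subgroup.mem_comap]
    have := pow_mem (onQudit_shiftX_mem d n ζ r) (q r : ℕ)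
    rwa [← map_pow] at this
  refine ⟨⟨_, h⟩, ?_⟩
  have := SendsBasis.tensor (A := fun r => (shiftX d ^ (q r : ℕ)).val) (q := 0) (p := q)
    (t := fun _ => 1) fun r => SendsBasis.shiftX_pow (q r : ℕ) (q r).2
  rwa [Finset.prod_const_one] at this

/-- Such an element is central. Commuting with the `Z_r`, whose joint eigenvalues separate the basis
vectors, makes it diagonal; commuting with the shifts makes the diagonal constant; monomiality makes
the constant a power of `ζ`. -/
lemma eq_zpow_pauliZeta_of_tau (hζ : IsPrimitiveRoot ζ (dbar d)) {g : pauli d n ζ}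
    (hg : tau d n hζ g = 1) : ∃ e : ℤ, g = pauliZeta d n ζ ^ e := by
  have hcomm : ∀ h : pauli d n ζ, Commute g h := fun h => by
    refine pauli_commute hζ ?_
    rw [hg, sympForm_eq_left, toAdd_one, map_zero]
  have hdiag : ∀ q, ∃ e : ℤ, SendsBasis g.1.val q q ((ζ ^ e : ℂˣ) : ℂ) := by
    intro q
    obtain ⟨p, e, hp⟩ := isMonomial_pauli g.2 q
    suffices p = q by subst this; exact ⟨e, hp⟩
    funext r
    have hZ : ∀ q : Fin n → Fin d, SendsBasis (pauliZ d n ζ r).1.val q q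
        (((ζ ^ 2) ^ (q r : ℕ) : ℂˣ) : ℂ) := fun q => by
      have := (SendsBasis.clockZ d (ζ ^ 2) (q r)).tensor_mulSingle (m := fun _ => d) r
      rwa [Function.update_eq_self] at this
    have h1 := hp.mul (hZ q)
    have h2 := (hZ p).mul hp
    have h3 : (g * pauliZ d n ζ r).1.val = (pauliZ d n ζ r * g).1.val := by
      rw [(hcomm (pauliZ d n ζ r)).eq]
    simp only [Subgroup.coe_mul, Units.val_mul] at h3
    rw [h3] at h1
    have h4 := h1.eq_coeff h2
    rw [mul_comm] at h4
    have h5 := mul_left_cancel₀ (Units.ne_zero (ζ ^ e)) h4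
    have h6 := (isPrimitiveRoot_sq hζ).pow_inj (q r).2 (p r).2 (Units.ext h5)
    exact Fin.ext h6.symm
  obtain ⟨e, he⟩ := hdiag 0
  refine ⟨e, Subtype.ext ?_⟩
  rw [Subgroup.coe_zpow]
  change g.1 = (scalarGL _ ζ) ^ e
  rw [← map_zpow]
  refine eq_scalarGL_of_sendsBasis fun q => ?_
  obtain ⟨f, hf⟩ := hdiag q
  obtain ⟨w, hw⟩ := exists_pauli_sendsBasis ζ q
  have h1 := hf.mul hw
  have h2 := hw.mul he
  have h3 : (g * w).1.val = (w * g).1.val := by rw [(hcomm w).eq]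
  simp only [Subgroup.coe_mul, Units.val_mul] at h3
  rw [h3] at h1
  have h4 := h1.eq_coeff h2
  rw [one_mul, mul_one] at h4
  rwa [h4] at hf

/-- By nondegeneracy of the form some `h` satisfies `g = s • h g h⁻¹` with a scalar `s ≠ 1`, and the
trace is invariant under conjugation. -/
lemma trace_eq_zero_of_tau (hζ : IsPrimitiveRoot ζ (dbar d)) {g : pauli d n ζ}
    (hg : tau d n hζ g ≠ 1) : g.1.val.trace = 0 := by
  obtain ⟨h, hh⟩ : ∃ h : pauli d n ζ,
      sympForm (tau d n hζ g).toAdd (tau d n hζ h).toAdd ≠ 0 := by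
    by_contra! H
    apply hg
    refine Multiplicative.toAdd.injective (Prod.ext (funext fun r => ?_) (funext fun r => ?_))
    · have := H (pauliX d n ζ r)
      rw [tau_pauliX, toAdd_ofAdd, sympForm_x_right] at this
      exact this
    · have := H (pauliZ d n ζ r)
      rw [tau_pauliZ, toAdd_ofAdd, sympForm_z_right, neg_eq_zero] at this
      exact this
  have h1 := pauli_mul_eq hζ g h
  set s := phase hζ (sympForm (tau d n hζ g).toAdd (tau d n hζ h).toAdd) with hs
  have hs1 : s ≠ 1 := fun h => hh ((phase_eq_one_iff hζ).mp h)
  have h2 : g.1 = scalarGL _ s * (h.1 * (g.1 * h.1⁻¹)) := by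
    rw [← mul_assoc h.1, ← mul_assoc, ← h1, mul_inv_cancel_right]
  have h3 : g.1.val.trace = s * g.1.val.trace := by
    conv_lhs => rw [h2]
    change (Matrix.scalar _ (s : ℂ) * (h.1.val * (g.1.val * h.1⁻¹.val))).trace = _
    rw [Matrix.scalar_apply, ← Matrix.smul_eq_diagonal_mul, Matrix.trace_smul, Matrix.trace_mul_comm,
      Matrix.mul_assoc, Units.inv_mul, Matrix.mul_one, smul_eq_mul]
  have h4 : ((s : ℂ) - 1) * g.1.val.trace = 0 := by linear_combination -h3
  rcases mul_eq_zero.mp h4 with h5 | h5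
  · exact absurd (Units.ext (by simpa using sub_eq_zero.mp h5)) hs1
  · exact h5

end Kernel

/-! ### The action of the Pauli group -/

section Action

variable {d n : ℕ} {ζ : ℂˣ}

lemma pauliAct_one (v : QuditSpace d n) : pauliAct (1 : pauli d n ζ) v = v := by
  change Matrix.toEuclideanLin (1 : Matrix (Fin n → Fin d) (Fin n → Fin d) ℂ) v = v
  rw [Matrix.toLpLin_one]; rfl

lemma pauliAct_mul (g h : pauli d n ζ) (v : QuditSpace d n) :
    pauliAct (g * h) v = pauliAct g (pauliAct h v) := by
  change Matrix.toEuclideanLin (g.1.val * h.1.val) v = _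
  rw [Matrix.toLpLin_mul 2 2 2]
  rfl

lemma pauliAct_inv (g : pauli d n ζ) {v w : QuditSpace d n} (h : pauliAct g v = w) :
    pauliAct g⁻¹ w = v := by
  rw [← h, ← pauliAct_mul, inv_mul_cancel, pauliAct_one]

lemma toEuclideanLin_scalarGL {J : Type*} [Fintype J] [DecidableEq J] (ω : ℂˣ)
    (v : EuclideanSpace ℂ J) : Matrix.toEuclideanLin (scalarGL J ω).val v = (ω : ℂ) • v := by
  ext i
  rw [Matrix.toLpLin_apply]
  change (Matrix.scalar J (ω : ℂ) *ᵥ v.ofLp) i = _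
  rw [Matrix.scalar_apply, Matrix.mulVec_diagonal]
  rfl

lemma pauliAct_zeta (v : QuditSpace d n) : pauliAct (pauliZeta d n ζ) v = (ζ : ℂ) • v :=
  toEuclideanLin_scalarGL ζ v

lemma pauliAct_zeta_zpow (e : ℤ) (v : QuditSpace d n) :
    pauliAct (pauliZeta d n ζ ^ e) v = ((ζ ^ e : ℂˣ) : ℂ) • v := by
  rw [← toEuclideanLin_scalarGL (ζ ^ e) v, map_zpow]
  rfl

lemma trace_pauliAct (g : pauli d n ζ) :
    LinearMap.trace ℂ (QuditSpace d n) (pauliAct g) = g.1.val.trace := by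
  rw [pauliAct, Matrix.toEuclideanLin, Matrix.toLpLin_eq_toLin, Matrix.trace_toLin_eq]

variable [NeZero d]

lemma pauliAct_pauliAct (hζ : IsPrimitiveRoot ζ (dbar d)) (g h : pauli d n ζ)
    (v : QuditSpace d n) : pauliAct g (pauliAct h v) =
      ((phase hζ (sympForm (tau d n hζ g).toAdd (tau d n hζ h).toAdd) : ℂˣ) : ℂ) •
        pauliAct h (pauliAct g v) := by
  rw [← pauliAct_mul, ← pauliAct_mul, ← toEuclideanLin_scalarGL]
  change Matrix.toEuclideanLin (g.1 * h.1).val v = _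
  rw [pauli_mul_eq hζ g h, Units.val_mul, Matrix.toLpLin_mul 2 2 2]
  rfl

lemma inner_pauliAct (hζ : IsPrimitiveRoot ζ (dbar d)) (g : pauli d n ζ) (v w : QuditSpace d n) :
    inner ℂ (pauliAct g v) (pauliAct g w) = inner ℂ v w := by
  have h : g.1⁻¹.val = g.1.valᴴ := pauli_le_unitaryGL hζ g.2
  have h2 : LinearMap.adjoint (pauliAct g) = pauliAct g⁻¹ := by
    rw [pauliAct, ← Matrix.toEuclideanLin_conjTranspose_eq_adjoint, ← h]
    rfl
  rw [← LinearMap.adjoint_inner_right, h2, ← pauliAct_mul, inv_mul_cancel, pauliAct_one]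

end Action

lemma natCast_mul_eq_zero {d a b : ℕ} (h : d ∣ a * b) : (a : ZMod d) * (b : ZMod d) = 0 := by
  rw [← Nat.cast_mul]
  exact (ZMod.natCast_eq_zero_iff _ _).mpr h

/-! ### Lifted symplectic frames -/

/-- Lifts `Z_i`, `X_i` of a symplectic basis `E_i`, `F_i`, that satisfy the standard relations. -/
structure PauliFrame {d n : ℕ} [NeZero d] {ζ : ℂˣ} (hζ : IsPrimitiveRoot ζ (dbar d))
    (ι : Type*) [Fintype ι] [DecidableEq ι] where
  Z : ι → pauli d n ζ
  X : ι → pauli d n ζ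
  E : ι → PhaseSpace d n
  F : ι → PhaseSpace d n
  tau_Z : ∀ i, tau d n hζ (Z i) = Multiplicative.ofAdd (E i)
  tau_X : ∀ i, tau d n hζ (X i) = Multiplicative.ofAdd (F i)
  pow_Z : ∀ i, Z i ^ d = 1
  pow_X : ∀ i, X i ^ d = 1
  form_EE : ∀ i j, sympForm (E i) (E j) = 0
  form_FF : ∀ i j, sympForm (F i) (F j) = 0
  form_EF : ∀ i j, sympForm (E i) (F j) = if i = j then 1 else 0
  -- Replaces the basis property: with the three form relations it says that `φ(·, F_i)` and `φ(E_i,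
  -- ·)` are the coordinates along `E_i` and `F_i`.
  expand : ∀ m, ∑ i, (sympForm m (F i) • E i + sympForm (E i) m • F i) = m

namespace PauliFrame

variable {d n : ℕ} [NeZero d] {ζ : ℂˣ} {hζ : IsPrimitiveRoot ζ (dbar d)}
  {ι : Type*} [Fintype ι] [DecidableEq ι] (P : PauliFrame (n := n) hζ ι)

/-- The coordinate along `E_i`. -/
def zc (i : ι) : PhaseSpace d n →ₗ[ZMod d] ZMod d := sympFormLeft (P.F i)

/-- The coordinate along `F_i`. -/
def xc (i : ι) : PhaseSpace d n →ₗ[ZMod d] ZMod d := sympFormRight (P.E i)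

lemma zc_E (i j : ι) : P.zc i (P.E j) = if j = i then 1 else 0 := P.form_EF j i

lemma zc_F (i j : ι) : P.zc i (P.F j) = 0 := P.form_FF j i

lemma xc_E (i j : ι) : P.xc i (P.E j) = 0 := P.form_EE i j

lemma xc_F (i j : ι) : P.xc i (P.F j) = if i = j then 1 else 0 := P.form_EF i j

lemma sum_coord (m : PhaseSpace d n) : ∑ i, (P.zc i m • P.E i + P.xc i m • P.F i) = m :=
  P.expand m

lemma zc_sum (i : ι) (s t : ι → ZMod d) :
    P.zc i (∑ j, (s j • P.E j + t j • P.F j)) = s i := by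
  simp [zc_E, zc_F]

lemma xc_sum (i : ι) (s t : ι → ZMod d) :
    P.xc i (∑ j, (s j • P.E j + t j • P.F j)) = t i := by
  simp [xc_E, xc_F]

lemma sympForm_E_right (m : PhaseSpace d n) (i : ι) : sympForm m (P.E i) = -P.xc i m :=
  sympForm_swap _ _

lemma sympForm_eq (m p : PhaseSpace d n) :
    sympForm m p = ∑ i, (P.zc i m * P.xc i p - P.xc i m * P.zc i p) := by
  conv_lhs => rw [← P.sum_coord p]
  rw [sympForm_eq_right, map_sum]
  refine Finset.sum_congr rfl fun i _ => ?_
  rw [map_add, map_smul, map_smul, ← sympForm_eq_right, ← sympForm_eq_right, sympForm_E_right,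
    show sympForm m (P.F i) = P.zc i m from rfl, smul_eq_mul, smul_eq_mul]
  ring

/-! ### The subgroups generated by powers of a frame: image under `τ`, orthogonal, normaliser -/

/-- The subgroup generated by the `Z_i^(α_i)` and the `X_i^(β_i)`. -/
def powSubgroup (α β : ι → ℕ) : Subgroup (pauli d n ζ) :=
  Subgroup.closure (Set.range (fun i => P.Z i ^ α i) ∪ Set.range (fun i => P.X i ^ β i))

variable {α β : ι → ℕ}

lemma Z_pow_mem (i : ι) : P.Z i ^ α i ∈ P.powSubgroup α β :=
  Subgroup.subset_closure (Or.inl ⟨i, rfl⟩)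

lemma X_pow_mem (i : ι) : P.X i ^ β i ∈ P.powSubgroup α β :=
  Subgroup.subset_closure (Or.inr ⟨i, rfl⟩)

lemma tau_Z_pow (i : ι) (t : ℕ) :
    (tau d n hζ (P.Z i ^ t)).toAdd = ((t : ℕ) : ZMod d) • P.E i := by
  rw [map_pow, P.tau_Z, toAdd_pow, toAdd_ofAdd, Nat.cast_smul_eq_nsmul]

lemma tau_X_pow (i : ι) (t : ℕ) :
    (tau d n hζ (P.X i ^ t)).toAdd = ((t : ℕ) : ZMod d) • P.F i := by
  rw [map_pow, P.tau_X, toAdd_pow, toAdd_ofAdd, Nat.cast_smul_eq_nsmul]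

lemma tau_mem_tauImage {H : Subgroup (pauli d n ζ)} {g : pauli d n ζ} (hg : g ∈ H) :
    (tau d n hζ g).toAdd ∈ tauImage hζ H := ⟨g, hg, rfl⟩

lemma mem_tauImage {H : Subgroup (pauli d n ζ)} {m : PhaseSpace d n} :
    m ∈ tauImage hζ H ↔ ∃ g ∈ H, (tau d n hζ g).toAdd = m := Iff.rfl

/-- A subgroup that contains the `Z_i^(α_i)` and `X_i^(β_i)` maps onto the vectors whose
coordinates are multiples of the `α_i` and `β_i`. -/
lemma mem_tauImage_of_coord {H : Subgroup (pauli d n ζ)} (hZ : ∀ i, P.Z i ^ α i ∈ H)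
    (hX : ∀ i, P.X i ^ β i ∈ H) {m : PhaseSpace d n}
    (hm : ∀ i, (∃ t : ℤ, P.zc i m = α i * t) ∧ ∃ t : ℤ, P.xc i m = β i * t) :
    m ∈ tauImage hζ H := by
  rw [← P.sum_coord m]
  refine sum_mem fun i _ => add_mem ?_ ?_
  · obtain ⟨t, ht⟩ := (hm i).1
    have := zsmul_mem (tau_mem_tauImage (hζ := hζ) (hZ i)) t
    rwa [tau_Z_pow, ← Int.cast_smul_eq_zsmul (ZMod d), smul_smul, mul_comm, ← ht] at this
  · obtain ⟨t, ht⟩ := (hm i).2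
    have := zsmul_mem (tau_mem_tauImage (hζ := hζ) (hX i)) t
    rwa [tau_X_pow, ← Int.cast_smul_eq_zsmul (ZMod d), smul_smul, mul_comm, ← ht] at this

lemma mem_tauImage_iff {m : PhaseSpace d n} : m ∈ tauImage hζ (P.powSubgroup α β) ↔
    ∀ i, (∃ t : ℤ, P.zc i m = α i * t) ∧ ∃ t : ℤ, P.xc i m = β i * t := by
  refine ⟨?_, P.mem_tauImage_of_coord P.Z_pow_mem P.X_pow_mem⟩
  rintro ⟨g, hg, rfl⟩ i
  change (∃ t : ℤ, P.zc i (tau d n hζ g).toAdd = α i * t) ∧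
    ∃ t : ℤ, P.xc i (tau d n hζ g).toAdd = β i * t
  induction hg using Subgroup.closure_induction with
  | mem x hx =>
    rcases hx with ⟨j, rfl⟩ | ⟨j, rfl⟩
    · rw [tau_Z_pow, map_smul, map_smul, zc_E, xc_E]
      refine ⟨?_, 0, by simp⟩
      by_cases h : j = i
      · subst h; exact ⟨1, by simp⟩
      · exact ⟨0, by simp [h]⟩
    · rw [tau_X_pow, map_smul, map_smul, zc_F, xc_F]
      refine ⟨⟨0, by simp⟩, ?_⟩
      by_cases h : i = j
      · subst h; exact ⟨1, by simp⟩
      · exact ⟨0, by simp [h]⟩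
  | one => exact ⟨⟨0, by simp⟩, ⟨0, by simp⟩⟩
  | mul x y _ _ hx hy =>
    obtain ⟨⟨t, ht⟩, ⟨s, hs⟩⟩ := hx
    obtain ⟨⟨t', ht'⟩, ⟨s', hs'⟩⟩ := hy
    rw [map_mul, toAdd_mul, map_add, map_add, ht, ht', hs, hs']
    exact ⟨⟨t + t', by push_cast; ring⟩, ⟨s + s', by push_cast; ring⟩⟩
  | inv x _ hx =>
    obtain ⟨⟨t, ht⟩, ⟨s, hs⟩⟩ := hx
    rw [map_inv, toAdd_inv, map_neg, map_neg, ht, hs]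
    exact ⟨⟨-t, by push_cast; ring⟩, ⟨-s, by push_cast; ring⟩⟩

/-- Pairing with the generators `β_i F_i` and `α_i E_i` reads off the two coordinates, up to sign,
multiplied by `β_i` and `α_i`. -/
lemma mem_perp_iff {m : PhaseSpace d n} : m ∈ perp (tauImage hζ (P.powSubgroup α β)) ↔
    ∀ i, (β i : ZMod d) * P.zc i m = 0 ∧ (α i : ZMod d) * P.xc i m = 0 := by
  constructor
  · intro h i
    constructor
    · have := h _ (tau_mem_tauImage (P.X_pow_mem (α := α) (β := β) i))
      rwa [tau_X_pow, sympForm_eq_right, map_smul] at this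
    · have := h _ (tau_mem_tauImage (P.Z_pow_mem (α := α) (β := β) i))
      rwa [tau_Z_pow, sympForm_eq_right, map_smul, ← sympForm_eq_right, sympForm_E_right,
        smul_neg, neg_eq_zero] at this
  · intro h p hp
    rw [mem_tauImage_iff] at hp
    rw [P.sympForm_eq]
    refine Finset.sum_eq_zero fun i _ => ?_
    obtain ⟨⟨t, ht⟩, ⟨s, hs⟩⟩ := hp i
    rw [ht, hs]
    linear_combination (s : ZMod d) * (h i).1 - (t : ZMod d) * (h i).2

lemma tauImage_le_perp (h : ∀ i, d ∣ α i * β i) :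
    tauImage hζ (P.powSubgroup α β) ≤ perp (tauImage hζ (P.powSubgroup α β)) := by
  intro m hm
  rw [mem_tauImage_iff] at hm
  rw [mem_perp_iff]
  intro i
  obtain ⟨⟨t, ht⟩, ⟨s, hs⟩⟩ := hm i
  have := natCast_mul_eq_zero (h i)
  rw [ht, hs]
  constructor
  · linear_combination (t : ZMod d) * this
  · linear_combination (s : ZMod d) * this

lemma commute_XX (i j : ι) (s t : ℕ) : Commute (P.X i ^ s) (P.X j ^ t) :=
  (pauli_commute hζ (by
    rw [P.tau_X, P.tau_X, toAdd_ofAdd, toAdd_ofAdd, P.form_FF])).pow_pow s t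

lemma commute_of_mem (h : ∀ i, d ∣ α i * β i) {x y : pauli d n ζ}
    (hx : x ∈ P.powSubgroup α β) (hy : y ∈ P.powSubgroup α β) : Commute x y :=
  pauli_commute hζ (P.tauImage_le_perp h (tau_mem_tauImage hx) _ (tau_mem_tauImage hy))

lemma tau_noncommPiCoprod {κ : Type*} [Fintype κ] (G : κ → pauli d n ζ)
    (hcomm : Pairwise fun s t => ∀ (x y : Multiplicative ℤ),
      Commute (zpowersHom _ (G s) x) (zpowersHom _ (G t) y)) (t : κ → Multiplicative ℤ) :
    (tau d n hζ (MonoidHom.noncommPiCoprod (fun s => zpowersHom _ (G s)) hcomm t)).toAdd =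
      ∑ s, ((t s).toAdd : ZMod d) • (tau d n hζ (G s)).toAdd := by
  have hprod : tau d n hζ (MonoidHom.noncommPiCoprod (fun s => zpowersHom _ (G s)) hcomm t) =
      ∏ s, tau d n hζ (zpowersHom _ (G s) (t s)) :=
    (Finset.map_noncommProd _ _ (fun i _ j _ hij => by exact hcomm hij _ _) _).trans
      (Finset.noncommProd_eq_prod _ _)
  rw [hprod, toAdd_prod]
  refine Finset.sum_congr rfl fun s _ => ?_
  rw [zpowersHom_apply, map_zpow, toAdd_zpow, Int.cast_smul_eq_zsmul]

/-- The map `τ` is injective on the subgroup generated by the `Z_i^(α_i)` and `X_i^(β_i)`. -/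
lemma eq_one_of_tau (h : ∀ i, d ∣ α i * β i) {x : pauli d n ζ}
    (hx : x ∈ P.powSubgroup α β) (hτ : tau d n hζ x = 1) : x = 1 := by
  -- The generators commute pairwise, so every element of the subgroup is a product of integer
  -- powers of them, that is, a value of a homomorphism from a free abelian group.
  let G : ι ⊕ ι → pauli d n ζ := Sum.elim (fun i => P.Z i ^ α i) (fun i => P.X i ^ β i)
  have hG : ∀ s, G s ∈ P.powSubgroup α β := by
    rintro (i | i)
    · exact P.Z_pow_mem i
    · exact P.X_pow_mem i
  have hcomm : Pairwise fun s t => ∀ (x y : Multiplicative ℤ),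
      Commute (zpowersHom _ (G s) x) (zpowersHom _ (G t) y) := fun s t _ x y =>
    P.commute_of_mem h (zpow_mem (hG s) _) (zpow_mem (hG t) _)
  let Φ := MonoidHom.noncommPiCoprod (fun s => zpowersHom _ (G s)) hcomm
  have hle : P.powSubgroup α β ≤ Φ.range := by
    rw [powSubgroup, Subgroup.closure_le, MonoidHom.noncommPiCoprod_range]
    rintro _ (⟨i, rfl⟩ | ⟨i, rfl⟩)
    · exact Subgroup.mem_iSup_of_mem (Sum.inl i) ⟨Multiplicative.ofAdd 1, by simp [G]⟩
    · exact Subgroup.mem_iSup_of_mem (Sum.inr i) ⟨Multiplicative.ofAdd 1, by simp [G]⟩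
  obtain ⟨t, rfl⟩ := hle hx
  have hsum : (tau d n hζ (Φ t)).toAdd =
      ∑ i, ((((α i * (t (Sum.inl i)).toAdd : ℤ)) : ZMod d) • P.E i +
        (((β i * (t (Sum.inr i)).toAdd : ℤ)) : ZMod d) • P.F i) := by
    rw [tau_noncommPiCoprod, Fintype.sum_sum_type, Finset.sum_add_distrib]
    congr 1
    · refine Finset.sum_congr rfl fun i _ => ?_
      rw [show G (Sum.inl i) = P.Z i ^ α i from rfl, tau_Z_pow, smul_smul]
      push_cast
      rw [mul_comm]
    · refine Finset.sum_congr rfl fun i _ => ?_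
      rw [show G (Sum.inr i) = P.X i ^ β i from rfl, tau_X_pow, smul_smul]
      push_cast
      rw [mul_comm]
  rw [hτ, toAdd_one] at hsum
  -- Each factor is trivial separately: the vanishing coordinate of `τ` says that `d` divides `α_i
  -- t_i` (or `β_i t_i`), so the factor is a power of `Z_i ^ d = 1` (or `X_i ^ d = 1`).
  suffices t ∈ Φ.ker from this
  refine Subgroup.pi_mem_of_mulSingle_mem t fun s => ?_
  rw [MonoidHom.mem_ker, MonoidHom.noncommPiCoprod_mulSingle, zpowersHom_apply]
  rcases s with i | i
  · have h1 := P.zc_sum i (fun i => (((α i * (t (Sum.inl i)).toAdd : ℤ)) : ZMod d))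
      (fun i => (((β i * (t (Sum.inr i)).toAdd : ℤ)) : ZMod d))
    rw [← hsum, map_zero] at h1
    obtain ⟨u, hu⟩ := (ZMod.intCast_zmod_eq_zero_iff_dvd _ _).mp h1.symm
    change (P.Z i ^ α i) ^ _ = 1
    rw [← zpow_natCast, ← _root_.zpow_mul, hu, _root_.zpow_mul, zpow_natCast, P.pow_Z, _root_.one_zpow]
  · have h1 := P.xc_sum i (fun i => (((α i * (t (Sum.inl i)).toAdd : ℤ)) : ZMod d))
      (fun i => (((β i * (t (Sum.inr i)).toAdd : ℤ)) : ZMod d))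
    rw [← hsum, map_zero] at h1
    obtain ⟨u, hu⟩ := (ZMod.intCast_zmod_eq_zero_iff_dvd _ _).mp h1.symm
    change (P.X i ^ β i) ^ _ = 1
    rw [← zpow_natCast, ← _root_.zpow_mul, hu, _root_.zpow_mul, zpow_natCast, P.pow_X, _root_.one_zpow]

lemma finite_powSubgroup (h : ∀ i, d ∣ α i * β i) : Finite (P.powSubgroup α β) := by
  refine Finite.of_injective (β := PhaseSpace d n)
    (fun x : P.powSubgroup α β => (tau d n hζ x.1).toAdd) fun x y hxy => ?_
  have h1 : tau d n hζ (x.1 * y.1⁻¹) = 1 := by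
    rw [map_mul, map_inv, mul_inv_eq_one]
    exact hxy
  exact Subtype.ext (mul_inv_eq_one.mp
    (P.eq_one_of_tau h (mul_mem x.2 (inv_mem y.2)) h1))

/-- Commutators lie in the kernel of `τ`, because its target is abelian. A commutator that also lies
in the subgroup is therefore trivial, so normalising the subgroup means commuting with each of its
elements. -/
lemma mem_normalizer_iff (h : ∀ i, d ∣ α i * β i) {g : pauli d n ζ} :
    g ∈ Subgroup.normalizer (P.powSubgroup α β : Set (pauli d n ζ)) ↔
      (tau d n hζ g).toAdd ∈ perp (tauImage hζ (P.powSubgroup α β)) := by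
  constructor
  · rintro hg _ ⟨x, hx, rfl⟩
    have h1 : g * x * g⁻¹ ∈ P.powSubgroup α β := (Subgroup.mem_normalizer_iff.mp hg x).mp hx
    have h2 : g * x * g⁻¹ * x⁻¹ = 1 := by
      refine P.eq_one_of_tau h (mul_mem h1 (inv_mem hx)) ?_
      simp only [map_mul, map_inv]
      rw [mul_inv_cancel_comm, mul_inv_cancel]
    have h3 : g.1 * x.1 = x.1 * g.1 := by
      have : g * x = x * g := by
        rw [mul_inv_eq_one, mul_inv_eq_iff_eq_mul] at h2
        exact h2
      exact congrArg Subtype.val this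
    have h4 := pauli_mul_eq hζ g x
    rw [h3] at h4
    have h5 := mul_right_cancel ((one_mul _).trans h4)
    exact (phase_eq_one_iff hζ).mp (scalarGL_injective ((map_one _).trans h5)).symm
  · intro hg
    rw [Subgroup.mem_normalizer_iff]
    have hc : ∀ x ∈ P.powSubgroup α β, g * x * g⁻¹ = x := fun x hx => by
      rw [(pauli_commute hζ (hg _ (tau_mem_tauImage hx))).eq, mul_inv_cancel_right]
    intro x
    refine ⟨fun hx => by rwa [hc x hx], fun hx => ?_⟩
    -- The conjugate `g x g⁻¹` lies in the subgroup and so commutes with `g`; cancelling one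
    -- conjugation shows that it equals `x`.
    have h1 := hc _ hx
    have h2 : g * x * g⁻¹ = x := by
      have := mul_right_cancel h1
      exact mul_left_cancel this
    rwa [h2] at hx

/-- Only a lower bound for the order is needed: it bounds the dimension of the stabiliser space from
above, and an orthonormal family will bound it from below. The vectors with coordinates `α_i u` and
`β_i v`, where `u < s_i` and `v < t_i`, are distinct since these numbers are less than `d`. -/
lemma prod_le_card (h : ∀ i, d ∣ α i * β i) {s t : ι → ℕ} (hs : ∀ i, α i * s i = d)
    (ht : ∀ i, β i * t i = d) : ∏ i, s i * t i ≤ Nat.card (P.powSubgroup α β) := by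
  have hd := NeZero.pos d
  have hmem : ∀ u : (∀ i, Fin (s i) × Fin (t i)), ∃ x ∈ P.powSubgroup α β,
      (tau d n hζ x).toAdd = ∑ j, (((α j * (u j).1 : ℕ) : ZMod d) • P.E j +
        ((β j * (u j).2 : ℕ) : ZMod d) • P.F j) := by
    intro u
    refine mem_tauImage.mp (P.mem_tauImage_iff.mpr fun i => ?_)
    rw [zc_sum, xc_sum]
    exact ⟨⟨(u i).1, by push_cast; rfl⟩, ⟨(u i).2, by push_cast; rfl⟩⟩
  choose x hx hτ using hmem
  have := P.finite_powSubgroup h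
  have hinj : Function.Injective (fun u => (⟨x u, hx u⟩ : P.powSubgroup α β)) := by
    intro u v huv
    have h1 : x u = x v := congrArg Subtype.val huv
    have h2 := hτ u
    rw [h1, hτ v] at h2
    have key : ∀ {a b : ℕ}, a * b = d → ∀ x y : Fin b,
        ((a * x : ℕ) : ZMod d) = ((a * y : ℕ) : ZMod d) → x = y := by
      intro a b hab x y hxy
      have ha : 0 < a := Nat.pos_of_ne_zero (by rintro rfl; omega)
      rw [ZMod.natCast_eq_natCast_iff'] at hxy
      rw [Nat.mod_eq_of_lt (by rw [← hab]; exact Nat.mul_lt_mul_of_pos_left x.2 ha),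
        Nat.mod_eq_of_lt (by rw [← hab]; exact Nat.mul_lt_mul_of_pos_left y.2 ha)] at hxy
      exact Fin.ext (Nat.eq_of_mul_eq_mul_left ha hxy)
    funext i
    have hz := congrArg (P.zc i) h2
    have hx := congrArg (P.xc i) h2
    rw [zc_sum, zc_sum] at hz
    rw [xc_sum, xc_sum] at hx
    exact Prod.ext (key (hs i) _ _ hz.symm) (key (ht i) _ _ hx.symm)
  have h1 := Nat.card_le_card_of_injective _ hinj
  simpa [Nat.card_pi] using h1

end PauliFrame

/-! ### Division in `ℤ/d` -/

section Division

variable {d : ℕ} [NeZero d]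

/-- The quotient by `q` of a multiple of `q` in `ℤ/d`, read modulo `c`. -/
def divCast (q c : ℕ) (z : ZMod d) : ZMod c := ((z.val / q : ℕ) : ZMod c)

/-- The representative of `q t` in `[0, d)` is `q (t mod b)`, so division of natural numbers by `q`
returns `t mod b`, which determines `t` modulo the divisor `c` of `b`. -/
lemma divCast_mul {q b c : ℕ} (hq : q * b = d) (hc : c ∣ b) (t : ℤ) :
    divCast q c ((q : ZMod d) * (t : ZMod d)) = (t : ZMod c) := by
  have hd := NeZero.pos d
  have hq0 : 0 < q := Nat.pos_of_ne_zero (by rintro rfl; omega)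
  have h1 : (((q : ZMod d) * (t : ZMod d)).val : ℤ) = q * (t % b) := by
    have := ZMod.val_intCast (n := d) (q * t)
    push_cast at this
    rw [this, ← hq, Nat.cast_mul, Int.mul_emod_mul_of_pos _ _ (by exact_mod_cast hq0)]
  have h2 : ((((q : ZMod d) * (t : ZMod d)).val / q : ℕ) : ℤ) = t % b := by
    rw [Int.natCast_ediv, h1, Int.mul_ediv_cancel_left _ (by exact_mod_cast hq0.ne')]
  rw [divCast, ← Int.cast_natCast, h2, ZMod.intCast_eq_intCast_iff]
  exact (Int.mod_modEq t b).of_dvd (by exact_mod_cast hc)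

lemma exists_eq_mul_of_mul_eq_zero {q b : ℕ} (hq : q * b = d) {z : ZMod d}
    (h : (b : ZMod d) * z = 0) : ∃ t : ℤ, z = q * t := by
  have hd := NeZero.pos d
  have hb0 : 0 < b := Nat.pos_of_ne_zero (by rintro rfl; omega)
  have h1 : d ∣ b * z.val := by
    rw [← ZMod.natCast_eq_zero_iff, Nat.cast_mul, ZMod.natCast_zmod_val, h]
  have h2 : b * q ∣ b * z.val := by rwa [mul_comm b q, hq]
  obtain ⟨t, ht⟩ := Nat.dvd_of_mul_dvd_mul_left hb0 h2
  exact ⟨t, by rw [← ZMod.natCast_zmod_val z, ht]; push_cast; rfl⟩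

/-- The cast from `ℤ/c` to `ℤ/d` is not additive, but its defect is a multiple of `c`, which the
factor `e = d / c` annihilates. This is why the form of `S_c` can be computed with integer
representatives. -/
lemma mul_cast_intCast {c e : ℕ} (h : c * e = d) (u : ℤ) :
    (e : ZMod d) * ((u : ZMod c).cast : ZMod d) = e * u := by
  have hd := NeZero.pos d
  have : NeZero c := ⟨by rintro rfl; omega⟩
  rw [← ZMod.natCast_val, ← sub_eq_zero, ← mul_sub]
  have h1 := ZMod.val_intCast (n := c) u
  have h2 : (((u : ZMod c).val : ℕ) : ZMod d) = ((u % c : ℤ) : ZMod d) := by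
    rw [← h1, Int.cast_natCast]
  rw [h2]
  have h3 : u % c - u = c * -(u / c) := by
    have := Int.emod_add_mul_ediv u c
    linarith
  have h4 : (e : ZMod d) * c = 0 := natCast_mul_eq_zero (by rw [mul_comm, h])
  rw [← Int.cast_sub, h3]
  push_cast
  linear_combination (-((u / c : ℤ) : ZMod d)) * h4

end Division

/-! ### The quotient `τ(H)^⊥ / τ(H)` -/

namespace PauliFrame

section Factors

variable {d : ℕ} {ι : Type*} {C q q' : ι → ℕ}

/-- The normal form of the exponents is `α = C q`, `β = C q'` with `C q q' = d`; their product is `C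
d`, so the subgroup is isotropic. -/
lemma dvd_mul_of_factor (hd : ∀ i, C i * q i * q' i = d) (i : ι) :
    d ∣ C i * q i * (C i * q' i) := ⟨C i, by rw [← hd i]; ring⟩

lemma divCast_zc [NeZero d] (hd : ∀ i, C i * q i * q' i = d) (i : ι) (t : ℤ) :
    divCast (q i) (C i) ((q i : ZMod d) * (t : ZMod d)) = (t : ZMod (C i)) :=
  divCast_mul (b := C i * q' i) (by rw [← hd i]; ring) (dvd_mul_right _ _) t

lemma divCast_xc [NeZero d] (hd : ∀ i, C i * q i * q' i = d) (i : ι) (t : ℤ) :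
    divCast (q' i) (C i) ((q' i : ZMod d) * (t : ZMod d)) = (t : ZMod (C i)) :=
  divCast_mul (b := C i * q i) (by rw [← hd i]; ring) (dvd_mul_right _ _) t

end Factors

variable {d n : ℕ} [NeZero d] {ζ : ℂˣ} {hζ : IsPrimitiveRoot ζ (dbar d)}
  {ι : Type*} [Fintype ι] [DecidableEq ι] (P : PauliFrame (n := n) hζ ι) {C q q' : ι → ℕ}

/-- The annihilator of `C_i q'_i` in `ℤ/d` is generated by the complementary divisor `q_i`, and that
of `C_i q_i` by `q'_i`. -/
lemma mem_perp_iff_exists (hd : ∀ i, C i * q i * q' i = d) {m : PhaseSpace d n} :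
    m ∈ perp (tauImage hζ (P.powSubgroup (fun i => C i * q i) fun i => C i * q' i)) ↔
      ∀ i, (∃ t : ℤ, P.zc i m = q i * t) ∧ ∃ t : ℤ, P.xc i m = q' i * t := by
  rw [mem_perp_iff]
  refine forall_congr' fun i => and_congr ⟨?_, ?_⟩ ⟨?_, ?_⟩
  · exact exists_eq_mul_of_mul_eq_zero (by rw [← hd i]; ring)
  · rintro ⟨t, ht⟩
    rw [ht, ← mul_assoc, natCast_mul_eq_zero ⟨1, by rw [← hd i]; ring⟩, zero_mul]
  · exact exists_eq_mul_of_mul_eq_zero (by rw [← hd i]; ring)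
  · rintro ⟨t, ht⟩
    rw [ht, ← mul_assoc, natCast_mul_eq_zero ⟨1, by rw [← hd i]; ring⟩, zero_mul]

/-- The coordinates on `τ(H)^⊥`, divided by `q_i` and `q'_i`. -/
noncomputable def perpCoord (hd : ∀ i, C i * q i * q' i = d) :
    perp (tauImage hζ (P.powSubgroup (fun i => C i * q i) fun i => C i * q' i)) →+
      ∀ i, ZMod (C i) × ZMod (C i) :=
  AddMonoidHom.mk' (fun m i => (divCast (q i) (C i) (P.zc i m.1), divCast (q' i) (C i) (P.xc i m.1)))
    fun m m' => by
      funext i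
      obtain ⟨⟨t, ht⟩, ⟨s, hs⟩⟩ := (P.mem_perp_iff_exists hd).mp m.2 i
      obtain ⟨⟨t', ht'⟩, ⟨s', hs'⟩⟩ := (P.mem_perp_iff_exists hd).mp m'.2 i
      simp only [AddSubgroup.coe_add, map_add, Pi.add_apply, Prod.mk_add_mk]
      rw [ht, ht', hs, hs', ← mul_add, ← mul_add, ← Int.cast_add, ← Int.cast_add, divCast_zc hd,
        divCast_zc hd, divCast_zc hd, divCast_xc hd, divCast_xc hd, divCast_xc hd, Int.cast_add,
        Int.cast_add]

lemma perpCoord_apply (hd : ∀ i, C i * q i * q' i = d)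
    (m : perp (tauImage hζ (P.powSubgroup (fun i => C i * q i) fun i => C i * q' i))) (i : ι) :
    P.perpCoord hd m i = (divCast (q i) (C i) (P.zc i m.1), divCast (q' i) (C i) (P.xc i m.1)) :=
  rfl

lemma perpCoord_surjective (hd : ∀ i, C i * q i * q' i = d) :
    Function.Surjective (P.perpCoord hd) := by
  intro u
  choose s hs using fun i => ZMod.intCast_surjective (u i).1
  choose t ht using fun i => ZMod.intCast_surjective (u i).2
  let m := ∑ i, (((q i : ZMod d) * (s i : ZMod d)) • P.E i +
    ((q' i : ZMod d) * (t i : ZMod d)) • P.F i)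
  have hm : m ∈ perp (tauImage hζ (P.powSubgroup (fun i => C i * q i) fun i => C i * q' i)) := by
    rw [P.mem_perp_iff_exists hd]
    intro i
    rw [zc_sum, xc_sum]
    exact ⟨⟨s i, rfl⟩, ⟨t i, rfl⟩⟩
  refine ⟨⟨m, hm⟩, funext fun i => ?_⟩
  rw [perpCoord_apply, zc_sum, xc_sum, divCast_zc hd, divCast_xc hd, hs, ht]

lemma perpCoord_ker (hd : ∀ i, C i * q i * q' i = d) :
    (P.perpCoord hd).ker =
      (tauImage hζ (P.powSubgroup (fun i => C i * q i) fun i => C i * q' i)).addSubgroupOf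
        (perp (tauImage hζ (P.powSubgroup (fun i => C i * q i) fun i => C i * q' i))) := by
  ext m
  rw [AddMonoidHom.mem_ker, AddSubgroup.mem_addSubgroupOf, mem_tauImage_iff, funext_iff]
  refine forall_congr' fun i => ?_
  obtain ⟨⟨t, ht⟩, ⟨s, hs⟩⟩ := (P.mem_perp_iff_exists hd).mp m.2 i
  rw [perpCoord_apply, Pi.zero_apply, Prod.mk_eq_zero]
  -- Among the multiples `e z` in `ℤ/d`, those of the form `C e w` have `C ∣ z`: in an integral
  -- equation modulo `d = e C b` the factor `e` cancels, and the ambiguity left is a multiple of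
  -- `C`.
  have key : ∀ {e b : ℕ} (_ : e * (C i * b) = d) (z : ℤ),
      (z : ZMod (C i)) = 0 ↔ ∃ w : ℤ, (e : ZMod d) * z = (C i * e : ℕ) * w := by
    intro e b heb z
    have hd0 := NeZero.pos d
    have he : (e : ℤ) ≠ 0 := by
      rintro h
      have : e = 0 := by exact_mod_cast h
      subst this
      omega
    rw [ZMod.intCast_zmod_eq_zero_iff_dvd]
    constructor
    · rintro ⟨w, rfl⟩
      exact ⟨w, by push_cast; ring⟩
    · rintro ⟨w, hw⟩
      have h1 : ((e * z - C i * e * w : ℤ) : ZMod d) = 0 := by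
        push_cast
        push_cast at hw
        rw [hw, sub_self]
      rw [ZMod.intCast_zmod_eq_zero_iff_dvd, ← heb] at h1
      obtain ⟨y, hy⟩ := h1
      refine ⟨w + b * y, mul_left_cancel₀ he ?_⟩
      push_cast at hy
      linear_combination hy
  rw [ht, hs, divCast_zc hd, divCast_xc hd]
  exact and_congr (key (b := q' i) (by rw [← hd i]; ring) t) (key (b := q i) (by rw [← hd i]; ring) s)

/-- Undivided coordinates are `q_i t` and `q'_i s`, so each summand of the form acquires the factor
`q_i q'_i = d / C_i`, which is the normalisation of the form of `S_{C_i}`. -/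
lemma sum_elemForm_perpCoord (hd : ∀ i, C i * q i * q' i = d)
    (m p : perp (tauImage hζ (P.powSubgroup (fun i => C i * q i) fun i => C i * q' i))) :
    ∑ i, elemForm d (C i) (P.perpCoord hd m i) (P.perpCoord hd p i) = sympForm m.1 p.1 := by
  rw [P.sympForm_eq]
  refine Finset.sum_congr rfl fun i _ => ?_
  obtain ⟨⟨t, ht⟩, ⟨s, hs⟩⟩ := (P.mem_perp_iff_exists hd).mp m.2 i
  obtain ⟨⟨t', ht'⟩, ⟨s', hs'⟩⟩ := (P.mem_perp_iff_exists hd).mp p.2 i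
  rw [perpCoord_apply, perpCoord_apply, ht, ht', hs, hs', divCast_zc hd, divCast_zc hd,
    divCast_xc hd, divCast_xc hd, elemForm]
  have hC : 0 < C i := Nat.pos_of_ne_zero (by
    intro h
    have := hd i
    rw [h, zero_mul, zero_mul] at this
    exact NeZero.ne d this.symm)
  have h1 : d / C i = q i * q' i := by
    rw [← hd i, mul_assoc, Nat.mul_div_cancel_left _ hC]
  have h2 := mul_cast_intCast (d := d) (c := C i) (e := q i * q' i) (by rw [← hd i]; ring)
    (t * s' - s * t')
  push_cast at h2
  rw [h1]
  push_cast
  rw [h2]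
  ring

/-- The isomorphism of `τ(H)^⊥ / τ(H)` with a sum of elementary symplectic modules. -/
lemma exists_perpQuotient_equiv (hd : ∀ i, C i * q i * q' i = d) :
    ∃ Ψ : (perp (tauImage hζ (P.powSubgroup (fun i => C i * q i) fun i => C i * q' i)) ⧸
        (tauImage hζ (P.powSubgroup (fun i => C i * q i) fun i => C i * q' i)).addSubgroupOf
          (perp (tauImage hζ (P.powSubgroup (fun i => C i * q i) fun i => C i * q' i)))) ≃+
        ∀ i, ZMod (C i) × ZMod (C i),
      ∀ m p : perp (tauImage hζ (P.powSubgroup (fun i => C i * q i) fun i => C i * q' i)),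
        ∑ i, elemForm d (C i) (Ψ (QuotientAddGroup.mk m) i) (Ψ (QuotientAddGroup.mk p) i) =
          sympForm m.1 p.1 := by
  refine ⟨(QuotientAddGroup.quotientAddEquivOfEq (P.perpCoord_ker hd).symm).trans
    (QuotientAddGroup.quotientKerEquivOfSurjective _ (P.perpCoord_surjective hd)),
    fun m p => ?_⟩
  exact P.sum_elemForm_perpCoord hd m p

end PauliFrame

/-! ### The dimension of the stabiliser subspace -/

section SubgroupSum

variable {d n : ℕ} {ζ : ℂˣ}

lemma trace_pauliAct_one :
    LinearMap.trace ℂ (QuditSpace d n) (pauliAct (1 : pauli d n ζ)) = (d : ℂ) ^ n := by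
  rw [trace_pauliAct]
  change (1 : Matrix (Fin n → Fin d) (Fin n → Fin d) ℂ).trace = _
  simp [Matrix.trace_one]

/-- The sum of the operators of a finite subgroup. -/
noncomputable def subgroupSum (H : Subgroup (pauli d n ζ)) [Fintype H] :
    QuditSpace d n →ₗ[ℂ] QuditSpace d n := ∑ h : H, pauliAct h.1

lemma pauliAct_subgroupSum {H : Subgroup (pauli d n ζ)} [Fintype H] {g : pauli d n ζ} (hg : g ∈ H)
    (v : QuditSpace d n) : pauliAct g (subgroupSum H v) = subgroupSum H v := by
  rw [subgroupSum, LinearMap.sum_apply, map_sum]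
  refine Fintype.sum_equiv (Equiv.mulLeft (⟨g, hg⟩ : H)) _ _ fun h => ?_
  rw [← pauliAct_mul]
  rfl

lemma subgroupSum_mem {H : Subgroup (pauli d n ζ)} [Fintype H] (v : QuditSpace d n) :
    subgroupSum H v ∈ stabSpace H := fun _ hg => pauliAct_subgroupSum hg v

lemma subgroupSum_apply_of_mem {H : Subgroup (pauli d n ζ)} [Fintype H] {v : QuditSpace d n}
    (hv : v ∈ stabSpace H) : subgroupSum H v = (Fintype.card H : ℂ) • v := by
  rw [subgroupSum, LinearMap.sum_apply, Finset.sum_congr rfl fun h _ => hv h.1 h.2]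
  rw [Finset.sum_const, Finset.card_univ, Nat.cast_smul_eq_nsmul]

lemma ofAdd_add_single {ι : Type*} [DecidableEq ι] (j : ι → ℤ) (i : ι) (t : ℤ) :
    (fun s => Multiplicative.ofAdd ((j + Pi.single i t : ι → ℤ) s)) =
      Pi.mulSingle i (Multiplicative.ofAdd t) * fun s => Multiplicative.ofAdd (j s) := by
  funext s
  by_cases hs : s = i
  · subst hs
    simp [mul_comm, ofAdd_add]
  · simp [hs]

end SubgroupSum

namespace PauliFrame

variable {d n : ℕ} [NeZero d] {ζ : ℂˣ} {hζ : IsPrimitiveRoot ζ (dbar d)}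
  {ι : Type*} [Fintype ι] [DecidableEq ι] (P : PauliFrame (n := n) hζ ι) {α β : ι → ℕ}

lemma pow_ne_zero_of_neZero : (d : ℂ) ^ n ≠ 0 :=
  pow_ne_zero _ (Nat.cast_ne_zero.mpr (NeZero.ne d))

/-- Since `τ` is injective on the subgroup, every element other than the identity has trace zero. -/
lemma trace_subgroupSum (h : ∀ i, d ∣ α i * β i) [Fintype (P.powSubgroup α β)] :
    LinearMap.trace ℂ _ (subgroupSum (P.powSubgroup α β)) = (d : ℂ) ^ n := by
  rw [subgroupSum, map_sum, Finset.sum_eq_single 1, ← trace_pauliAct_one (ζ := ζ)]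
  · rfl
  · intro x _ hx
    rw [trace_pauliAct]
    refine trace_eq_zero_of_tau hζ fun hτ => hx (Subtype.ext (P.eq_one_of_tau h x.2 hτ))
  · simp

lemma exists_stabSpace_ne_zero (h : ∀ i, d ∣ α i * β i) :
    ∃ v ∈ stabSpace (P.powSubgroup α β), v ≠ 0 := by
  have := P.finite_powSubgroup h
  have := Fintype.ofFinite (P.powSubgroup α β)
  by_contra! H
  have h0 : subgroupSum (P.powSubgroup α β) = 0 := LinearMap.ext fun v => H _ (subgroupSum_mem v)
  have h1 := P.trace_subgroupSum h
  rw [h0, map_zero] at h1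
  exact pow_ne_zero_of_neZero h1.symm

/-- The average over the subgroup is a projection onto the stabiliser space, so its trace is the
dimension. -/
lemma finrank_stabSpace (h : ∀ i, d ∣ α i * β i) :
    Module.finrank ℂ (stabSpace (P.powSubgroup α β)) * Nat.card (P.powSubgroup α β) = d ^ n := by
  have := P.finite_powSubgroup h
  have := Fintype.ofFinite (P.powSubgroup α β)
  have hc : (Fintype.card (P.powSubgroup α β) : ℂ) ≠ 0 := Nat.cast_ne_zero.mpr Fintype.card_ne_zero
  have hproj : LinearMap.IsProj (stabSpace (P.powSubgroup α β))
      ((Fintype.card (P.powSubgroup α β) : ℂ)⁻¹ • subgroupSum (P.powSubgroup α β)) := by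
    refine ⟨fun v => Submodule.smul_mem _ _ (subgroupSum_mem v), fun v hv => ?_⟩
    rw [LinearMap.smul_apply, subgroupSum_apply_of_mem hv, inv_smul_smul₀ hc]
  have h1 := hproj.trace
  rw [map_smul, P.trace_subgroupSum h, smul_eq_mul, inv_mul_eq_iff_eq_mul₀ hc] at h1
  rw [Nat.card_eq_fintype_card, mul_comm]
  exact_mod_cast h1.symm

/-- An element that fixes the stabiliser subspace pointwise lies in the subgroup. -/
lemma mem_of_fixes (h : ∀ i, d ∣ α i * β i) {g : pauli d n ζ}
    (hg : ∀ v ∈ stabSpace (P.powSubgroup α β), pauliAct g v = v) : g ∈ P.powSubgroup α β := by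
  have := P.finite_powSubgroup h
  have := Fintype.ofFinite (P.powSubgroup α β)
  -- Because `g` fixes the image of the subgroup sum, the sum over the coset of `g` is the same
  -- operator and has nonzero trace. Hence some `g x` has nonzero trace and is a power of `ζ`.
  have h1 : subgroupSum (P.powSubgroup α β) = ∑ x : P.powSubgroup α β, pauliAct (g * x.1) := by
    refine LinearMap.ext fun v => ?_
    rw [← hg _ (subgroupSum_mem v), subgroupSum, LinearMap.sum_apply, LinearMap.sum_apply, map_sum]
    exact Finset.sum_congr rfl fun x _ => (pauliAct_mul _ _ _).symm
  have h2 := P.trace_subgroupSum h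
  rw [h1, map_sum] at h2
  obtain ⟨x, -, hx⟩ := Finset.exists_ne_zero_of_sum_ne_zero (h2.trans_ne pow_ne_zero_of_neZero)
  rw [trace_pauliAct] at hx
  have h3 : tau d n hζ (g * x.1) = 1 := by
    by_contra hτ
    exact hx (trace_eq_zero_of_tau hζ hτ)
  obtain ⟨e, he⟩ := eq_zpow_pauliZeta_of_tau hζ h3
  -- The scalar fixes a nonzero vector, so it is 1 and `g = x⁻¹`.
  obtain ⟨v, hv, hv0⟩ := P.exists_stabSpace_ne_zero h
  have h4 : pauliAct (g * x.1) v = v := by rw [pauliAct_mul, hv x.1 x.2, hg v hv]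
  rw [he, pauliAct_zeta_zpow] at h4
  have h5 : ζ ^ e = 1 := by
    refine Units.ext (smul_left_injective ℂ hv0 ?_)
    simpa using h4
  have h6 : g * x.1 = 1 := by
    rw [he]
    refine Subtype.ext ?_
    rw [Subgroup.coe_zpow]
    change (scalarGL _ ζ) ^ e = 1
    rw [← map_zpow, h5, map_one]
  rw [eq_inv_of_mul_eq_one_left h6]
  exact inv_mem x.2

lemma mem_stabSpace_powSubgroup {v : QuditSpace d n} (hZ : ∀ i, pauliAct (P.Z i ^ α i) v = v)
    (hX : ∀ i, pauliAct (P.X i ^ β i) v = v) : v ∈ stabSpace (P.powSubgroup α β) := by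
  intro g hg
  induction hg using Subgroup.closure_induction with
  | mem x hx =>
    rcases hx with ⟨i, rfl⟩ | ⟨i, rfl⟩
    · exact hZ i
    · exact hX i
  | one => exact pauliAct_one v
  | mul x y _ _ hx hy => rw [pauliAct_mul, hy, hx]
  | inv x _ hx => exact pauliAct_inv x hx

/-! ### An adapted basis of the stabiliser subspace -/

variable {C q q' : ι → ℕ}

lemma pairwise_commute_X (q' : ι → ℕ) : Pairwise fun i j => ∀ (x y : Multiplicative ℤ),
    Commute (zpowersHom _ (P.X i ^ q' i) x) (zpowersHom _ (P.X j ^ q' j) y) := fun i j _ x y =>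
  (P.commute_XX i j (q' i) (q' j)).zpow_zpow x.toAdd y.toAdd

/-- The product of the `X_i^(q'_i j_i)`. -/
noncomputable def shiftHom (q' : ι → ℕ) : (ι → Multiplicative ℤ) →* pauli d n ζ :=
  MonoidHom.noncommPiCoprod (fun i => zpowersHom _ (P.X i ^ q' i)) (P.pairwise_commute_X q')

lemma shiftHom_mulSingle (q' : ι → ℕ) (i : ι) (t : ℤ) :
    P.shiftHom q' (Pi.mulSingle i (Multiplicative.ofAdd t)) = (P.X i ^ q' i) ^ t :=
  MonoidHom.noncommPiCoprod_mulSingle _ _ _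

lemma tau_shiftHom (q' : ι → ℕ) (t : ι → Multiplicative ℤ) :
    (tau d n hζ (P.shiftHom q' t)).toAdd =
      ∑ i, ((0 : ZMod d) • P.E i + (((t i).toAdd : ZMod d) * (q' i : ZMod d)) • P.F i) := by
  rw [shiftHom, tau_noncommPiCoprod]
  refine Finset.sum_congr rfl fun i _ => ?_
  rw [tau_X_pow, smul_smul, zero_smul, zero_add]

/-- Eigenvectors of a unitary operator for distinct eigenvalues are orthogonal; distinct residues
give distinct eigenvalues because `ξ` has order exactly `d`. -/
lemma inner_eq_zero_of_phase (g : pauli d n ζ) {v w : QuditSpace d n} {s t : ZMod d}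
    (hv : pauliAct g v = ((phase hζ s : ℂˣ) : ℂ) • v)
    (hw : pauliAct g w = ((phase hζ t : ℂˣ) : ℂ) • w) (hst : s ≠ t) : inner ℂ v w = 0 := by
  have h1 := inner_pauliAct hζ g v w
  rw [hv, hw, inner_smul_left, inner_smul_right] at h1
  have h2 : ‖((phase hζ s : ℂˣ) : ℂ)‖ = 1 := by
    refine (IsPrimitiveRoot.coe_units_iff.mpr (isPrimitiveRoot_sq hζ)).norm'_eq_one
      (NeZero.ne d) |> fun h => ?_
    change ‖(((ζ ^ 2) ^ s.val : ℂˣ) : ℂ)‖ = 1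
    rw [Units.val_pow_eq_pow_val, norm_pow, h, one_pow]
  have h3 : (starRingEnd ℂ) ((phase hζ s : ℂˣ) : ℂ) = ((phase hζ (-s) : ℂˣ) : ℂ) := by
    rw [AddChar.map_neg_eq_inv]
    exact star_eq_inv_of_norm h2
  rw [h3, ← mul_assoc, ← Units.val_mul, ← AddChar.map_add_eq_mul] at h1
  have h4 : phase hζ (-s + t) ≠ 1 := fun h =>
    hst (by have := (phase_eq_one_iff hζ).mp h; linear_combination -this)
  by_contra hne
  exact h4 (Units.ext (mul_right_cancel₀ hne (h1.trans (one_mul _).symm)))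

/-- The stabiliser subspace has an orthonormal basis of common eigenvectors of the `Z_i^(q_i)`,
permuted by the `X_i^(q'_i)`. -/
lemma exists_stabSpace_basis (hd : ∀ i, C i * q i * q' i = d) (hn : Fintype.card ι = n)
    {J : Type*} [Fintype J] [DecidableEq J] (hJ : Fintype.card J = ∏ i, C i) (e : J → ι → ℤ)
    (he : ∀ p p', p ≠ p' → ∃ i, ¬ (C i : ℤ) ∣ e p i - e p' i) :
    ∃ (u : (ι → ℤ) → QuditSpace d n)
      (U : stabSpace (P.powSubgroup (fun i => C i * q i) fun i => C i * q' i) ≃ₗᵢ[ℂ]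
        EuclideanSpace ℂ J),
      (∀ j i, pauliAct (P.Z i ^ q i) (u j) =
        ((phase hζ ((q i * q' i * j i : ℤ) : ZMod d) : ℂˣ) : ℂ) • u j) ∧
      (∀ j i, pauliAct (P.X i ^ q' i) (u j) = u (j + Pi.single i 1)) ∧
      (∀ j i, u (j + Pi.single i (C i : ℤ)) = u j) ∧
      ∀ p, (U.symm (EuclideanSpace.single p 1) : QuditSpace d n) = u (e p) := by
  have hd0 := NeZero.pos d
  -- The group generated by `Z_i ^ q_i` and `X_i ^ (C_i q'_i)` is still isotropic and contains `H`.
  -- A vector fixed by it serves as the origin of the basis.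
  have h0 : ∀ i, d ∣ q i * (C i * q' i) := fun i => ⟨1, by rw [← hd i]; ring⟩
  obtain ⟨v, hv, hv0⟩ := P.exists_stabSpace_ne_zero h0
  obtain ⟨w, hw, hw1⟩ : ∃ w ∈ stabSpace (P.powSubgroup q fun i => C i * q' i), ‖w‖ = 1 := by
    refine ⟨((‖v‖ : ℂ)⁻¹) • v, Submodule.smul_mem _ _ hv, ?_⟩
    rw [norm_smul, norm_inv, Complex.norm_real, norm_norm, inv_mul_cancel₀ (norm_ne_zero_iff.mpr hv0)]
  -- Integer indices make the shift `X_i ^ q'_i` literally the translation by 1. The wrap-around is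
  -- deferred to `hper`, which holds because `X_i ^ (C_i q'_i)` fixes `w`.
  let u : (ι → ℤ) → QuditSpace d n := fun j =>
    pauliAct (P.shiftHom q' fun i => Multiplicative.ofAdd (j i)) w
  have hadd : ∀ j i t, u (j + Pi.single i t) = pauliAct ((P.X i ^ q' i) ^ t) (u j) := by
    intro j i t
    change pauliAct (P.shiftHom q' _) w = _
    rw [ofAdd_add_single, map_mul, pauliAct_mul, shiftHom_mulSingle]
  have hZ : ∀ j i t, pauliAct (P.Z i ^ (t * q i)) (u j) =
        ((phase hζ ((t * q i * q' i * j i : ℤ) : ZMod d) : ℂˣ) : ℂ) • u j := by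
    intro j i t
    have h1 : pauliAct (P.Z i ^ (t * q i)) w = w := by
      rw [mul_comm, pow_mul]
      exact hw _ (pow_mem (P.Z_pow_mem i) t)
    change pauliAct _ (pauliAct _ w) = _
    rw [pauliAct_pauliAct hζ, h1, tau_Z_pow, sympForm_eq_left, map_smul, ← sympForm_eq_left,
      show sympForm (P.E i) _ = P.xc i _ from rfl, tau_shiftHom, xc_sum, smul_eq_mul]
    congr 4
    push_cast
    rw [toAdd_ofAdd]
    ring
  have hper : ∀ j i, u (j + Pi.single i (C i : ℤ)) = u j := by
    intro j i
    have h1 : j + Pi.single i (C i : ℤ) = 0 + Pi.single i (C i : ℤ) + j := by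
      rw [zero_add, add_comm]
    change pauliAct (P.shiftHom q' _) w = _
    rw [ofAdd_add_single, mul_comm, map_mul, pauliAct_mul, shiftHom_mulSingle, zpow_natCast,
      ← pow_mul, mul_comm (q' i)]
    rw [hw _ (P.X_pow_mem i)]
  have hmem : ∀ j, u j ∈ stabSpace (P.powSubgroup (fun i => C i * q i) fun i => C i * q' i) := by
    intro j
    refine P.mem_stabSpace_powSubgroup (fun i => ?_) fun i => ?_
    · rw [hZ]
      have h1 : ((C i * q i * q' i * j i : ℤ) : ZMod d) = 0 := by
        have : ((C i * q i * q' i : ℕ) : ZMod d) = 0 := by rw [hd i, ZMod.natCast_self]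
        push_cast at this ⊢
        rw [this, zero_mul]
      rw [h1, AddChar.map_zero_eq_one, Units.val_one, one_smul]
    · have := hper j i
      rwa [hadd, zpow_natCast, ← pow_mul, mul_comm (q' i)] at this
  have hZ1 : ∀ j i, pauliAct (P.Z i ^ q i) (u j) =
        ((phase hζ ((q i * q' i * j i : ℤ) : ZMod d) : ℂˣ) : ℂ) • u j := fun j i => by
    have := hZ j i 1
    rwa [one_mul, Nat.cast_one, one_mul] at this
  let b : J → stabSpace (P.powSubgroup (fun i => C i * q i) fun i => C i * q' i) := fun p =>
    ⟨u (e p), hmem _⟩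
  have hb : Orthonormal ℂ b := by
    refine ⟨fun p => ?_, fun p p' hp => ?_⟩
    · change ‖u (e p)‖ = 1
      rw [← hw1, @norm_eq_sqrt_re_inner ℂ, @norm_eq_sqrt_re_inner ℂ _ _ _ _ w, inner_pauliAct hζ]
    · obtain ⟨i, hi⟩ := he p p' hp
      refine inner_eq_zero_of_phase _ (hZ1 (e p) i) (hZ1 (e p') i) fun h => hi ?_
      -- Equal eigenvalues would mean that `d = C_i q_i q'_i` divides `q_i q'_i` times the
      -- difference of the indices; cancelling leaves divisibility by `C_i`.
      rw [← sub_eq_zero, ← Int.cast_sub, ZMod.intCast_zmod_eq_zero_iff_dvd, ← mul_sub, ← hd i] at h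
      have hne : (q i * q' i : ℤ) ≠ 0 := by
        intro h0
        have h0' : q i * q' i = 0 := by exact_mod_cast h0
        have := hd i
        rw [mul_assoc, h0', mul_zero] at this
        omega
      refine Int.dvd_of_mul_dvd_mul_left hne ?_
      rw [show (q i * q' i * C i : ℤ) = ((C i * q i * q' i : ℕ) : ℤ) by push_cast; ring]
      exact h
  have hcard : Fintype.card J = Module.finrank ℂ
      (stabSpace (P.powSubgroup (fun i => C i * q i) fun i => C i * q' i)) := by
    -- Orthonormality gives one inequality. For the other, the dimension times the order of `H` is
    -- `d^n = ∏ C_i · ∏ q'_i q_i`, and that order is at least `∏ q'_i q_i`.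
    refine le_antisymm hb.linearIndependent.fintype_card_le_finrank ?_
    have h1 := P.finrank_stabSpace (dvd_mul_of_factor hd)
    have h2 := P.prod_le_card (dvd_mul_of_factor hd) (s := q') (t := q) hd
      fun i => by rw [← hd i]; ring
    have h3 : (∏ i, C i) * ∏ i, q' i * q i = d ^ n := by
      rw [← Finset.prod_mul_distrib, ← hn, ← Finset.card_univ, ← Finset.prod_const]
      exact Finset.prod_congr rfl fun i _ => by rw [← hd i]; ring
    have h4 : 0 < ∏ i, q' i * q i := Nat.pos_of_ne_zero fun h => by
      rw [h, mul_zero] at h3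
      exact (pow_pos hd0 n).ne h3
    rw [hJ]
    refine Nat.le_of_mul_le_mul_right ?_ h4
    rw [h3, ← h1]
    exact Nat.mul_le_mul_left _ h2
  have hJ0 : Nonempty J := by
    rw [← Fintype.card_pos_iff, hJ]
    refine Finset.prod_pos fun i _ => Nat.pos_of_ne_zero fun h => ?_
    have := hd i
    rw [h, zero_mul, zero_mul] at this
    omega
  let B := (basisOfOrthonormalOfCardEqFinrank hb hcard).toOrthonormalBasis
    (by rw [coe_basisOfOrthonormalOfCardEqFinrank]; exact hb)
  refine ⟨u, B.repr, hZ1, fun j i => ?_, hper, fun p => ?_⟩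
  · rw [hadd, zpow_one]
  · rw [OrthonormalBasis.repr_symm_single]
    simp [B, b]

end PauliFrame

/-! ### Quotients identified by a relation -/

/-- Goursat's lemma for a relation with surjective projections and prescribed kernels. -/
lemma exists_quotient_equiv {N K : Type*} [Group N] [Group K] {I : Subgroup (N × K)}
    (h1 : ∀ x, ∃ k, (x, k) ∈ I) (h2 : ∀ k, ∃ x, (x, k) ∈ I) {A : Subgroup N} {B : Subgroup K}
    [A.Normal] [B.Normal] (hA : ∀ x, x ∈ A ↔ (x, 1) ∈ I) (hB : ∀ k, k ∈ B ↔ (1, k) ∈ I) :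
    ∃ Φ : N ⧸ A ≃* K ⧸ B, ∀ x k, Φ (QuotientGroup.mk x) = QuotientGroup.mk k ↔ (x, k) ∈ I := by
  have hI1 : Function.Surjective (Prod.fst ∘ I.subtype) := fun x => by
    obtain ⟨k, hk⟩ := h1 x
    exact ⟨⟨(x, k), hk⟩, rfl⟩
  have hI2 : Function.Surjective (Prod.snd ∘ I.subtype) := fun k => by
    obtain ⟨x, hk⟩ := h2 k
    exact ⟨⟨(x, k), hk⟩, rfl⟩
  have hA' : A = I.goursatFst := by ext x; rw [hA, Subgroup.mem_goursatFst]
  have hB' : B = I.goursatSnd := by ext x; rw [hB, Subgroup.mem_goursatSnd]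
  subst hA' hB'
  obtain ⟨e, he⟩ := Subgroup.goursat_surjective hI1 hI2
  have hmem : ∀ x k, (x, k) ∈ I → e (QuotientGroup.mk x) = QuotientGroup.mk k := by
    intro x k hxk
    have : ((QuotientGroup.mk x, QuotientGroup.mk k) :
        (N ⧸ I.goursatFst) × (K ⧸ I.goursatSnd)) ∈ e.toMonoidHom.graph := by
      rw [← he]
      exact ⟨⟨(x, k), hxk⟩, rfl⟩
    exact this
  refine ⟨e, fun x k => ⟨fun h => ?_, hmem x k⟩⟩
  -- Some `k'` is related to `x`, and `k'⁻¹ k` is related to 1 by the equality of classes; the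
  -- product of the two pairs is `(x, k)`.
  obtain ⟨k', hk'⟩ := h1 x
  rw [hmem x k' hk', QuotientGroup.eq, Subgroup.mem_goursatSnd] at h
  have := mul_mem hk' h
  simpa using this

/-! ### The `ζ`-product acts faithfully -/

section Mixed

variable {d l k : ℕ} {ζ : ℂˣ} {c : Fin k → ℕ}

/-- The matrix of `mixedAct`. -/
def mixedMat (g : ∀ r, pauliOneExt d (c r) ζ) (h : pauli d l ζ) :
    Matrix ((∀ r, Fin (c r)) × (Fin l → Fin d)) ((∀ r, Fin (c r)) × (Fin l → Fin d)) ℂ :=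
  Matrix.kroneckerMap (· * ·) (tensorGL c fun r => (g r).1).val h.1.val

lemma mixedAct_eq (g : ∀ r, pauliOneExt d (c r) ζ) (h : pauli d l ζ) :
    mixedAct g h = Matrix.toEuclideanLin (mixedMat g h) := rfl

lemma mixedMat_mul (g g' : ∀ r, pauliOneExt d (c r) ζ) (h h' : pauli d l ζ) :
    mixedMat (g * g') (h * h') = mixedMat g h * mixedMat g' h' := by
  have : (fun r => ((g * g') r).1) = (fun r => (g r).1) * fun r => (g' r).1 := rfl
  rw [mixedMat, this, map_mul, Units.val_mul, Subgroup.coe_mul, Units.val_mul,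
    Matrix.mul_kronecker_mul]
  rfl

lemma mixedMat_one : mixedMat (1 : ∀ r, pauliOneExt d (c r) ζ) (1 : pauli d l ζ) = 1 := by
  have : (fun r => ((1 : ∀ r, pauliOneExt d (c r) ζ) r).1) = 1 := rfl
  rw [mixedMat, this, map_one, Units.val_one, Subgroup.coe_one, Units.val_one]
  exact Matrix.one_kronecker_one

lemma mixedAct_mul (g g' : ∀ r, pauliOneExt d (c r) ζ) (h h' : pauli d l ζ)
    (w : MixedSpace d l c) : mixedAct (g * g') (h * h') w = mixedAct g h (mixedAct g' h' w) := by
  rw [mixedAct_eq, mixedMat_mul, Matrix.toLpLin_mul 2 2 2]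
  rfl

lemma mixedAct_one (w : MixedSpace d l c) :
    mixedAct (1 : ∀ r, pauliOneExt d (c r) ζ) (1 : pauli d l ζ) w = w := by
  rw [mixedAct_eq, mixedMat_one, Matrix.toLpLin_one]
  rfl

lemma SendsBasis.mixedMat_left (r : Fin k) {g : pauliOneExt d (c r) ζ}
    {p : (∀ r, Fin (c r)) × (Fin l → Fin d)} {j : Fin (c r)} {t : ℂ}
    (h : SendsBasis g.1.val (p.1 r) j t) :
    SendsBasis (mixedMat (Pi.mulSingle r g) (1 : pauli d l ζ)) p
      (Function.update p.1 r j, p.2) t := by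
  have h1 : (fun s => ((Pi.mulSingle (M := fun r => pauliOneExt d (c r) ζ) r g) s).1) =
      Pi.mulSingle r g.1 := by
    funext s
    by_cases hs : s = r
    · subst hs; simp
    · rw [Pi.mulSingle_eq_of_ne hs, Pi.mulSingle_eq_of_ne hs, Subgroup.coe_one]
  rw [mixedMat, h1]
  have := (h.tensor_mulSingle r).kronecker (SendsBasis.one p.2)
  rwa [mul_one] at this

lemma SendsBasis.mixedMat_right {h : pauli d l ζ}
    {p : (∀ r, Fin (c r)) × (Fin l → Fin d)} {p' : Fin l → Fin d} {t : ℂ}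
    (hh : SendsBasis h.1.val p.2 p' t) :
    SendsBasis (mixedMat (1 : ∀ r, pauliOneExt d (c r) ζ) h) p (p.1, p') t := by
  have h1 : (fun r => ((1 : ∀ r, pauliOneExt d (c r) ζ) r).1) = 1 := rfl
  rw [mixedMat, h1, map_one]
  have := (SendsBasis.one p.1).kronecker hh
  rwa [one_mul] at this

lemma eq_zpow_pauliOneExtZeta {m : ℕ} {g : pauliOneExt d m ζ} {e : ℤ}
    (h : g.1 = scalarGL _ (ζ ^ e)) : g = pauliOneExtZeta d m ζ ^ e := by
  refine Subtype.ext ?_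
  rw [h, map_zpow, Subgroup.coe_zpow]
  rfl

lemma eq_zpow_pauliZeta {h : pauli d l ζ} {e : ℤ}
    (hh : h.1 = scalarGL _ (ζ ^ e)) : h = pauliZeta d l ζ ^ e := by
  refine Subtype.ext ?_
  rw [hh, map_zpow, Subgroup.coe_zpow]
  rfl

lemma zpow_mem_zetaRel (e : Fin k → ℤ) :
    ((fun r => pauliOneExtZeta d (c r) ζ ^ e r, pauliZeta d l ζ ^ (-∑ r, e r)) :
      (∀ r, pauliOneExt d (c r) ζ) × pauli d l ζ) ∈
      zetaRel (G := fun r => pauliOneExt d (c r) ζ) (fun r => pauliOneExtZeta d (c r) ζ)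
        (pauliZeta d l ζ) := by
  -- Powers of the scalars `ζ` commute, so the pairs in question are the values of a homomorphism.
  -- It suffices to test it on families supported at one index, where its value is a power of a
  -- defining relation.
  let θ : (Fin k → Multiplicative ℤ) →* (∀ r, pauliOneExt d (c r) ζ) × pauli d l ζ :=
    { toFun := fun t => (fun r => pauliOneExtZeta d (c r) ζ ^ (t r).toAdd,
        pauliZeta d l ζ ^ (-∑ r, (t r).toAdd))
      map_one' := by
        refine Prod.ext (funext fun r => ?_) ?_ <;> simp
      map_mul' := fun s t => by
        refine Prod.ext (funext fun r => ?_) ?_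
        · simp [_root_.zpow_add]
        · simp [_root_.zpow_add, Finset.sum_add_distrib, add_comm] }
  have h : (fun r => Multiplicative.ofAdd (e r)) ∈
      (zetaRel (G := fun r => pauliOneExt d (c r) ζ) (fun r => pauliOneExtZeta d (c r) ζ)
        (pauliZeta d l ζ)).comap θ := by
    refine Subgroup.pi_mem_of_mulSingle_mem _ fun r => ?_
    rw [Subgroup.mem_comap]
    have h1 := zpow_mem (Subgroup.subset_normalClosure (Set.mem_range_self r) :
      ((Pi.mulSingle r (pauliOneExtZeta d (c r) ζ), (pauliZeta d l ζ)⁻¹) :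
        (∀ r, pauliOneExt d (c r) ζ) × pauli d l ζ) ∈ zetaRel
          (G := fun r => pauliOneExt d (c r) ζ) (fun r => pauliOneExtZeta d (c r) ζ)
          (pauliZeta d l ζ)) (e r)
    convert h1 using 1
    refine Prod.ext (funext fun s => ?_) ?_
    · by_cases hs : s = r
      · subst hs
        simp [θ]
      · simp [θ, hs]
    · have : ∑ s, (Pi.mulSingle (M := fun _ => Multiplicative ℤ) r
          (Multiplicative.ofAdd (e r)) s).toAdd = e r := by
        rw [Finset.sum_eq_single r]
        · simp
        · intro s _ hs
          simp [hs]
        · simp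
      simp [θ, this]
  exact h

/-- The `ζ`-product acts faithfully. A tensor product equal to 1 has nonzero diagonal entries, so
every monomial factor is diagonal; changing one index at a time shows that each factor is a scalar
power of `ζ`; and the exponents cancel up to the order of `ζ`. -/
lemma mem_zetaRel_of_mixedMat [NeZero d] (hc : ∀ r, c r ≠ 0) {g : ∀ r, pauliOneExt d (c r) ζ}
    {h : pauli d l ζ} (hM : mixedMat g h = 1) :
    (g, h) ∈ zetaRel (G := fun r => pauliOneExt d (c r) ζ) (fun r => pauliOneExtZeta d (c r) ζ)
      (pauliZeta d l ζ) := by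
  have hc' : ∀ r, NeZero (c r) := fun r => ⟨hc r⟩
  have hentry : ∀ (p : ∀ r, Fin (c r)) (p' : Fin l → Fin d),
      (∏ r, (g r).1.val (p r) (p r)) * h.1.val p' p' = 1 := by
    intro p p'
    have := congrFun (congrFun hM (p, p')) (p, p')
    rwa [Matrix.one_apply_eq] at this
  have hg : ∀ r a, ∃ e : ℤ, SendsBasis (g r).1.val a a ((ζ ^ e : ℂˣ) : ℂ) := by
    intro r a
    refine (isMonomial_pauliOneExt (g r).2).sendsBasis_self fun h0 => ?_
    have := hentry (Function.update 0 r a) 0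
    rw [Finset.prod_eq_zero (Finset.mem_univ r) (by rw [Function.update_self]; exact h0),
      zero_mul] at this
    exact zero_ne_one this
  have hh : ∀ a, ∃ e : ℤ, SendsBasis h.1.val a a ((ζ ^ e : ℂˣ) : ℂ) := by
    intro a
    refine (isMonomial_pauli h.2).sendsBasis_self fun h0 => ?_
    have := hentry 0 a
    rw [h0, mul_zero] at this
    exact zero_ne_one this
  choose E hE using hg
  choose F hF using hh
  have hsum : ∀ (p : ∀ r, Fin (c r)) (p' : Fin l → Fin d),
      (∏ r, ζ ^ E r (p r)) * ζ ^ F p' = 1 := by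
    intro p p'
    refine Units.ext ?_
    rw [Units.val_mul, Units.coe_prod, Units.val_one, ← hentry p p', hF p' p', if_pos rfl]
    congr 1
    exact Finset.prod_congr rfl fun r _ => by rw [hE r (p r) (p r), if_pos rfl]
  have hEconst : ∀ r a, ζ ^ E r a = ζ ^ E r 0 := by
    intro r a
    have h1 := hsum (Function.update 0 r a) 0
    have h2 := hsum 0 0
    rw [← h2] at h1
    have h3 := mul_right_cancel h1
    rw [← Finset.mul_prod_erase _ _ (Finset.mem_univ r),
      ← Finset.mul_prod_erase _ (fun s => ζ ^ E s ((0 : ∀ r, Fin (c r)) s)) (Finset.mem_univ r),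
      Function.update_self, Finset.prod_congr rfl fun s hs => by
        rw [Function.update_of_ne (Finset.ne_of_mem_erase hs)]] at h3
    exact mul_right_cancel h3
  have hFconst : ∀ a, ζ ^ F a = ζ ^ F 0 := fun a =>
    mul_left_cancel ((hsum 0 a).trans (hsum 0 0).symm)
  have hg' : g = fun r => pauliOneExtZeta d (c r) ζ ^ E r 0 := funext fun r =>
    eq_zpow_pauliOneExtZeta (eq_scalarGL_of_sendsBasis fun a => hEconst r a ▸ hE r a)
  have hh' : h = pauliZeta d l ζ ^ (-∑ r, E r 0) := by
    refine eq_zpow_pauliZeta (eq_scalarGL_of_sendsBasis fun a => ?_)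
    have h1 : ζ ^ (-∑ r, E r 0) = ζ ^ F a := by
      have h2 : ζ ^ (∑ r, E r 0) = ∏ r, ζ ^ E r 0 :=
        map_sum (zpowersHom ℂˣ ζ).toAdditiveRight (fun r => E r 0) Finset.univ
      rw [_root_.zpow_neg, h2]
      exact inv_eq_of_mul_eq_one_right (hsum 0 a)
    rw [h1]
    exact hF a
  rw [hg', hh']
  exact zpow_mem_zetaRel _

end Mixed

/-! ### The intertwining relation -/

lemma shiftX_mem_pauliOneExt {d c : ℕ} [NeZero d] {ζ : ℂˣ} (hζ : IsPrimitiveRoot ζ (dbar d))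
    (hc : c ∣ d) : shiftX c ∈ pauliOneExt d c ζ := by
  rw [pauliOneExt_eq_closure hζ hc]
  exact Subgroup.subset_closure (Or.inl rfl)

lemma clockZ_mem_pauliOneExt {d c : ℕ} [NeZero d] {ζ : ℂˣ} (hζ : IsPrimitiveRoot ζ (dbar d))
    (hc : c ∣ d) : clockZ c ((ζ ^ 2) ^ (d / c)) ∈ pauliOneExt d c ζ := by
  rw [pauliOneExt_eq_closure hζ hc]
  exact Subgroup.subset_closure (Or.inr (Or.inl rfl))

/-- Compares the cyclic shift with addition of 1 in `ℤ`; the two differ by the period `m` or not at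
all. -/
lemma finRotate_val_add (m : ℕ) (j : Fin m) :
    (j : ℤ) + 1 = (finRotate m j : ℕ) ∨ (j : ℤ) + 1 = (finRotate m j : ℕ) + m := by
  have : NeZero m := ⟨by have := j.2; omega⟩
  have h1 : ((finRotate m j : Fin m) : ℕ) = (j + 1) % m := by
    rw [finRotate_apply, Fin.val_add]
    have : ((1 : Fin m) : ℕ) = 1 % m := Fin.val_one' m
    rw [this, Nat.add_mod_mod]
  have hj := j.2
  rcases Nat.lt_or_ge (j + 1) m with h | h
  · left
    rw [h1, Nat.mod_eq_of_lt h]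
    push_cast; rfl
  · right
    have h2 : (j : ℕ) + 1 = m := by omega
    rw [h1, h2, Nat.mod_self]
    omega

section Relation

variable {d n l k : ℕ} {ζ : ℂˣ} {c : Fin k → ℕ} {V : Submodule ℂ (QuditSpace d n)}
  (U : V ≃ₗᵢ[ℂ] MixedSpace d l c)

/-- The pairs of operators that correspond under `U`. -/
def intertwiner : Subgroup (pauli d n ζ × ((∀ r, pauliOneExt d (c r) ζ) × pauli d l ζ)) where
  carrier := {x | ∀ w, pauliAct x.1 (U.symm w : QuditSpace d n) = U.symm (mixedAct x.2.1 x.2.2 w)}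
  one_mem' := fun w => by
    change pauliAct 1 _ = ((U.symm (mixedAct 1 1 w) : V) : QuditSpace d n)
    rw [pauliAct_one, mixedAct_one]
  mul_mem' := fun {x y} hx hy w => by
    change pauliAct (x.1 * y.1) _ =
      ((U.symm (mixedAct (x.2.1 * y.2.1) (x.2.2 * y.2.2) w) : V) : QuditSpace d n)
    rw [pauliAct_mul, hy w, hx, mixedAct_mul]
  inv_mem' := fun {x} hx w => by
    refine pauliAct_inv x.1 ?_
    rw [hx, ← mixedAct_mul]
    change ((U.symm (mixedAct (x.2.1 * x.2.1⁻¹) (x.2.2 * x.2.2⁻¹) w) : V) : QuditSpace d n) = _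
    rw [mul_inv_cancel, mul_inv_cancel, mixedAct_one]

/-- Both sides of the intertwining relation are linear, so it may be checked on basis vectors, which
monomial operators merely permute and rescale. -/
lemma mem_intertwiner_of_basis {U : V ≃ₗᵢ[ℂ] MixedSpace d l c} {x : pauli d n ζ}
    {g : ∀ r, pauliOneExt d (c r) ζ} {h : pauli d l ζ}
    (H : ∀ p, ∃ p' t, SendsBasis (mixedMat g h) p p' t ∧
      pauliAct x (U.symm (EuclideanSpace.single p 1) : QuditSpace d n) =
        t • (U.symm (EuclideanSpace.single p' 1) : QuditSpace d n)) :
    (x, (g, h)) ∈ intertwiner U := by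
  have h1 : pauliAct x ∘ₗ V.subtype ∘ₗ U.symm.toLinearEquiv.toLinearMap =
      V.subtype ∘ₗ U.symm.toLinearEquiv.toLinearMap ∘ₗ mixedAct g h := by
    refine (EuclideanSpace.basisFun _ ℂ).toBasis.ext fun p => ?_
    obtain ⟨p', t, hp, hx⟩ := H p
    rw [OrthonormalBasis.coe_toBasis, EuclideanSpace.basisFun_apply]
    change pauliAct x (U.symm (EuclideanSpace.single p 1) : QuditSpace d n) =
      ((U.symm (mixedAct g h (EuclideanSpace.single p 1)) : V) : QuditSpace d n)
    rw [hx, mixedAct_eq, hp.toEuclideanLin, map_smul]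
    rfl
  exact fun w => LinearMap.congr_fun h1 w

end Relation

/-! ### The normaliser quotient and its action on the stabiliser space -/

namespace PauliFrame

variable {d n k l : ℕ} [NeZero d] {ζ : ℂˣ} {hζ : IsPrimitiveRoot ζ (dbar d)}
  (P : PauliFrame (n := n) hζ (Fin k ⊕ Fin l)) {C q q' : Fin k ⊕ Fin l → ℕ}

/-- In coordinates `τ(H)^⊥` is the image of the group generated by the `Z_i ^ q_i` and `X_i ^ q'_i`.
Together with `ζ` these elements therefore generate `N(H)`. -/
lemma mem_normalizer_iff_mem_tauImage (hd : ∀ i, C i * q i * q' i = d) {x : pauli d n ζ} :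
    x ∈ Subgroup.normalizer
        (P.powSubgroup (fun i => C i * q i) (fun i => C i * q' i) : Set (pauli d n ζ)) ↔
      (tau d n hζ x).toAdd ∈ tauImage hζ (P.powSubgroup q q') := by
  rw [P.mem_normalizer_iff (dvd_mul_of_factor hd), P.mem_perp_iff_exists hd, P.mem_tauImage_iff]

/-- A unitary isomorphism of `V^H` with a tensor product, under which the generators of `N(H)`
correspond to the generators of the tensor factors. -/
lemma exists_intertwining_isometry (hn : k + l = n) (hd : ∀ i, C i * q i * q' i = d)
    (hCr : ∀ s, C (Sum.inr s) = d) :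
    ∃ U : stabSpace (P.powSubgroup (fun i => C i * q i) fun i => C i * q' i) ≃ₗᵢ[ℂ]
        MixedSpace d l fun r => C (Sum.inl r),
      ((pauliZeta d n ζ, (1, pauliZeta d l ζ)) ∈ intertwiner U ∧
        ∀ r, (pauliZeta d n ζ, (Pi.mulSingle r (pauliOneExtZeta d (C (Sum.inl r)) ζ), 1)) ∈
          intertwiner U) ∧
      ((∀ r (g : pauliOneExt d (C (Sum.inl r)) ζ), g.1 = shiftX _ →
          (P.X (Sum.inl r) ^ q' (Sum.inl r), (Pi.mulSingle r g, 1)) ∈ intertwiner U) ∧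
        ∀ s, (P.X (Sum.inr s) ^ q' (Sum.inr s), (1, pauliX d l ζ s)) ∈ intertwiner U) ∧
      (∀ r (g : pauliOneExt d (C (Sum.inl r)) ζ),
          g.1 = clockZ _ ((ζ ^ 2) ^ (d / C (Sum.inl r))) →
          (P.Z (Sum.inl r) ^ q (Sum.inl r), (Pi.mulSingle r g, 1)) ∈ intertwiner U) ∧
        ∀ s, (P.Z (Sum.inr s) ^ q (Sum.inr s), (1, pauliZ d l ζ s)) ∈ intertwiner U := by
  have hd0 := NeZero.pos d
  have hC0 : ∀ i, C i ≠ 0 := fun i h => by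
    have := hd i
    rw [h, zero_mul, zero_mul] at this
    omega
  have hdiv : ∀ i, d / C i = q i * q' i := fun i => by
    rw [← hd i, mul_assoc, Nat.mul_div_cancel_left _ (Nat.pos_of_ne_zero (hC0 i))]
  -- The last `l` indices live in `Fin d` and not in `Fin (C (Sum.inr s))`, which is only
  -- propositionally the same type; passing to integers avoids the transport.
  let e : (∀ r, Fin (C (Sum.inl r))) × (Fin l → Fin d) → Fin k ⊕ Fin l → ℤ := fun p =>
    Sum.elim (fun r => (p.1 r : ℕ)) fun s => (p.2 s : ℕ)
  have he : ∀ p p', p ≠ p' → ∃ i, ¬ (C i : ℤ) ∣ e p i - e p' i := by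
    intro p p' hp
    by_contra! H
    have key : ∀ {m : ℕ} (x y : Fin m), (m : ℤ) ∣ (x : ℕ) - (y : ℕ) → x = y := by
      intro m x y hxy
      have h1 := Int.eq_zero_of_abs_lt_dvd hxy (by
        rw [abs_lt]
        have := x.2
        have := y.2
        constructor <;> omega)
      exact Fin.ext (by omega)
    refine hp (Prod.ext (funext fun r => key _ _ (H (Sum.inl r))) (funext fun s => key _ _ ?_))
    have := H (Sum.inr s)
    rw [hCr] at this
    exact this
  obtain ⟨u, U, hZ, hX, hper, hU⟩ := P.exists_stabSpace_basis hd
    (by rw [Fintype.card_sum, Fintype.card_fin, Fintype.card_fin, hn])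
    (J := (∀ r, Fin (C (Sum.inl r))) × (Fin l → Fin d))
    (by simp [Fintype.prod_sum_type, hCr]) e he
  -- The cyclic successor of an index agrees with the integer successor up to one period `C_i`,
  -- under which `u` is invariant.
  have hshift : ∀ p p' i (j j' : Fin (C i)), e p i = (j : ℕ) → j' = finRotate _ j →
      e p' = Function.update (e p) i (j' : ℕ) → u (e p + Pi.single i 1) = u (e p') := by
    intro p p' i j j' hj hj' hp'
    have h1 : ∀ t : ℤ, (j : ℤ) + 1 = (j' : ℕ) + t →
        e p + Pi.single i 1 = e p' + Pi.single i t := by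
      intro t ht
      rw [hp']
      funext s
      by_cases hs : s = i
      · subst hs
        simp only [Pi.add_apply, Pi.single_eq_same, Function.update_self, hj]
        exact ht
      · simp [hs]
    rcases finRotate_val_add _ j with h | h
    · rw [h1 0 (by rw [hj', add_zero]; exact h), Pi.single_zero, add_zero]
    · rw [h1 (C i) (by rw [hj']; exact h), hper]
  let R := intertwiner (ζ := ζ) U
  have hRζ : (pauliZeta d n ζ, ((1 : ∀ r, pauliOneExt d (C (Sum.inl r)) ζ), pauliZeta d l ζ)) ∈ R :=
    mem_intertwiner_of_basis fun p => ⟨p, ζ, SendsBasis.mixedMat_right (SendsBasis.scalar ζ p.2),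
      pauliAct_zeta _⟩
  have hRζ' : ∀ r, (pauliZeta d n ζ,
      (Pi.mulSingle r (pauliOneExtZeta d (C (Sum.inl r)) ζ), (1 : pauli d l ζ))) ∈ R := fun r =>
    mem_intertwiner_of_basis fun p => ⟨p, ζ, by
      have := SendsBasis.mixedMat_left (ζ := ζ) (g := pauliOneExtZeta d (C (Sum.inl r)) ζ) r
        (p := p) (SendsBasis.scalar ζ (p.1 r))
      rwa [Function.update_eq_self] at this, pauliAct_zeta _⟩
  have hRX : ∀ r (g : pauliOneExt d (C (Sum.inl r)) ζ), g.1 = shiftX _ →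
      (P.X (Sum.inl r) ^ q' (Sum.inl r), (Pi.mulSingle r g, (1 : pauli d l ζ))) ∈ R := by
    intro r g hg
    refine mem_intertwiner_of_basis fun p => ⟨_, 1, SendsBasis.mixedMat_left r
      (by rw [hg]; exact SendsBasis.shiftX _ _), ?_⟩
    rw [hU, hU, hX, one_smul]
    refine hshift p _ (Sum.inl r) (p.1 r) _ rfl rfl ?_
    funext s
    rcases s with s | s
    · by_cases hs : s = r
      · subst hs; simp [e]
      · simp [e, hs]
    · simp [e]
  have hRX' : ∀ s, (P.X (Sum.inr s) ^ q' (Sum.inr s),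
      ((1 : ∀ r, pauliOneExt d (C (Sum.inl r)) ζ), pauliX d l ζ s)) ∈ R := by
    intro s
    refine mem_intertwiner_of_basis fun p => ⟨_, 1, SendsBasis.mixedMat_right
      ((SendsBasis.shiftX d (p.2 s)).tensor_mulSingle (m := fun _ => d) s), ?_⟩
    rw [hU, hU, hX, one_smul]
    refine hshift p _ (Sum.inr s) (Fin.cast (hCr s).symm (p.2 s))
      (Fin.cast (hCr s).symm (finRotate d (p.2 s))) rfl ?_ ?_
    · have : ∀ m (hm : d = m) (j : Fin d), Fin.cast hm (finRotate d j) =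
          finRotate m (Fin.cast hm j) := by
        rintro m rfl j; rfl
      exact this _ _ _
    · funext i
      rcases i with i | i
      · simp [e]
      · by_cases hs : i = s
        · subst hs; simp [e]
        · simp [e, hs]
  -- The eigenvalue of `Z_i ^ q_i` is `ξ ^ (q_i q'_i j)`, and `q_i q'_i = d / C_i` makes it the
  -- `j`-th entry of the clock for `ξ ^ (d / C_i)`.
  have hphase : ∀ i (j : ℕ), phase hζ ((q i * q' i * (j : ℤ) : ℤ) : ZMod d) =
      ((ζ ^ 2) ^ (d / C i)) ^ j := by
    intro i j
    rw [hdiv, ← pow_mul, ← phase_natCast hζ]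
    push_cast
    rfl
  have hRZ : ∀ r (g : pauliOneExt d (C (Sum.inl r)) ζ),
      g.1 = clockZ _ ((ζ ^ 2) ^ (d / C (Sum.inl r))) →
      (P.Z (Sum.inl r) ^ q (Sum.inl r), (Pi.mulSingle r g, (1 : pauli d l ζ))) ∈ R := by
    intro r g hg
    refine mem_intertwiner_of_basis fun p => ⟨p, _, ?_, by rw [hU, hZ]⟩
    have := SendsBasis.mixedMat_left (ζ := ζ) (g := g) r (p := p)
      (by rw [hg]; exact SendsBasis.clockZ _ _ _)
    rw [Function.update_eq_self] at this
    convert this using 2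
    exact hphase (Sum.inl r) (p.1 r)
  have hRZ' : ∀ s, (P.Z (Sum.inr s) ^ q (Sum.inr s),
      ((1 : ∀ r, pauliOneExt d (C (Sum.inl r)) ζ), pauliZ d l ζ s)) ∈ R := by
    intro s
    refine mem_intertwiner_of_basis fun p => ⟨p, _, ?_, by rw [hU, hZ]⟩
    have := SendsBasis.mixedMat_right (c := fun r => C (Sum.inl r)) (h := pauliZ d l ζ s) (p := p)
      ((SendsBasis.clockZ d (ζ ^ 2) (p.2 s)).tensor_mulSingle (m := fun _ => d) s)
    rw [Function.update_eq_self] at this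
    convert this using 2
    have := hphase (Sum.inr s) (p.2 s)
    rwa [hCr, Nat.div_self hd0, pow_one] at this
  exact ⟨U, ⟨hRζ, hRζ'⟩, ⟨hRX, hRX'⟩, hRZ, hRZ'⟩

/-- The structure of `N(H)/H` and of its action on `V^H`. -/
theorem exists_normQuot_equiv (hn : k + l = n) (hd : ∀ i, C i * q i * q' i = d)
    (hCr : ∀ s, C (Sum.inr s) = d) :
    ∃ (Φ : NormQuot (P.powSubgroup (fun i => C i * q i) fun i => C i * q' i) ≃*
          PauliProd d l ζ fun r => C (Sum.inl r))
      (U : stabSpace (P.powSubgroup (fun i => C i * q i) fun i => C i * q' i) ≃ₗᵢ[ℂ]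
        MixedSpace d l fun r => C (Sum.inl r)),
      (∀ x : Subgroup.normalizer
          (P.powSubgroup (fun i => C i * q i) (fun i => C i * q' i) : Set (pauli d n ζ)),
        (x : pauli d n ζ) = pauliZeta d n ζ →
        Φ (QuotientGroup.mk x) = QuotientGroup.mk (1, pauliZeta d l ζ)) ∧
      ∀ (x : Subgroup.normalizer
          (P.powSubgroup (fun i => C i * q i) (fun i => C i * q' i) : Set (pauli d n ζ)))
        (g : ∀ r, pauliOneExt d (C (Sum.inl r)) ζ) (h : pauli d l ζ),
        Φ (QuotientGroup.mk x) = QuotientGroup.mk (g, h) →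
        ∀ w, pauliAct (x : pauli d n ζ) (U.symm w : QuditSpace d n) =
            (U.symm (mixedAct g h w) : QuditSpace d n) := by
  have hd0 := NeZero.pos d
  have hC0 : ∀ i, C i ≠ 0 := fun i h => by
    have := hd i
    rw [h, zero_mul, zero_mul] at this
    omega
  have hdvd : ∀ i, C i ∣ d := fun i => ⟨q i * q' i, by rw [← hd i, mul_assoc]⟩
  obtain ⟨U, ⟨hRζ, hRζ'⟩, ⟨hRX, hRX'⟩, hRZ, hRZ'⟩ := P.exists_intertwining_isometry hn hd hCr
  let R := intertwiner (ζ := ζ) U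
  have hNmem : ∀ {x : pauli d n ζ}, x ∈ P.powSubgroup q q' → x ∈ Subgroup.normalizer
      (P.powSubgroup (fun i => C i * q i) (fun i => C i * q' i) : Set (pauli d n ζ)) := fun hx =>
    (P.mem_normalizer_iff_mem_tauImage hd).mpr (tau_mem_tauImage hx)
  have hNζ : pauliZeta d n ζ ∈ Subgroup.normalizer
      (P.powSubgroup (fun i => C i * q i) (fun i => C i * q' i) : Set (pauli d n ζ)) := by
    rw [P.mem_normalizer_iff_mem_tauImage hd, tau_pauliZeta]
    exact zero_mem _
  let N := Subgroup.normalizer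
      (P.powSubgroup (fun i => C i * q i) (fun i => C i * q' i) : Set (pauli d n ζ))
  let K := (∀ r, pauliOneExt d (C (Sum.inl r)) ζ) × pauli d l ζ
  -- The correspondence under `U`, restricted to the normaliser; Goursat's lemma is applied to this
  -- relation.
  let I : Subgroup (N × K) := R.comap (N.subtype.prodMap (MonoidHom.id K))
  have hKgen : ∀ (x : pauli d n ζ) (hx : x ∈ N) (y : K), (x, y) ∈ R →
      y ∈ I.map (MonoidHom.snd N K) := fun x hx y hxy => ⟨(⟨x, hx⟩, y), hxy, rfl⟩
  have hKtop : ∀ y : K, y ∈ I.map (MonoidHom.snd N K) := by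
    have hl : ∀ r (g : pauliOneExt d (C (Sum.inl r)) ζ),
        ((Pi.mulSingle r g, 1) : K) ∈ I.map (MonoidHom.snd N K) := by
      intro r
      let f : pauliOneExt d (C (Sum.inl r)) ζ →* K :=
        (MonoidHom.inl _ _).comp (MonoidHom.mulSingle (fun r => pauliOneExt d (C (Sum.inl r)) ζ) r)
      -- The generators live in the ambient `GL`, so the claim is pushed forward along the inclusion
      -- and checked on the closure there.
      have hle : pauliOneExt d (C (Sum.inl r)) ζ ≤
          ((I.map (MonoidHom.snd N K)).comap f).map (Subgroup.subtype _) := by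
        conv_lhs => rw [pauliOneExt_eq_closure hζ (hdvd _)]
        rw [Subgroup.closure_le]
        rintro _ (rfl | rfl | rfl)
        · exact ⟨⟨_, shiftX_mem_pauliOneExt hζ (hdvd _)⟩, hKgen _ (hNmem (P.X_pow_mem _)) _ (hRX r ⟨_, shiftX_mem_pauliOneExt hζ (hdvd _)⟩ rfl), rfl⟩
        · exact ⟨⟨_, clockZ_mem_pauliOneExt hζ (hdvd _)⟩, hKgen _ (hNmem (P.Z_pow_mem _)) _
            (hRZ r ⟨_, clockZ_mem_pauliOneExt hζ (hdvd _)⟩ rfl), rfl⟩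
        · exact ⟨pauliOneExtZeta d _ ζ, hKgen _ hNζ _ (hRζ' r), rfl⟩
      intro g
      obtain ⟨g', hg', hgg⟩ := hle g.2
      have : g' = g := Subtype.ext hgg
      rw [this] at hg'
      exact hg'
    have hr : ∀ h : pauli d l ζ, ((1, h) : K) ∈ I.map (MonoidHom.snd N K) := by
      let f : pauli d l ζ →* K := MonoidHom.inr _ _
      have hle : pauli d l ζ ≤
          ((I.map (MonoidHom.snd N K)).comap f).map (Subgroup.subtype _) := by
        conv_lhs => rw [pauli]
        rw [Subgroup.closure_le]
        rintro _ ((⟨s, rfl⟩ | ⟨s, rfl⟩) | rfl)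
        · exact ⟨pauliZ d l ζ s, hKgen _ (hNmem (P.Z_pow_mem _)) _ (hRZ' s), rfl⟩
        · exact ⟨pauliX d l ζ s, hKgen _ (hNmem (P.X_pow_mem _)) _ (hRX' s), rfl⟩
        · exact ⟨pauliZeta d l ζ, hKgen _ hNζ _ hRζ, rfl⟩
      intro h
      obtain ⟨h', hh', hhh⟩ := hle h.2
      have : h' = h := Subtype.ext hhh
      rw [this] at hh'
      exact hh'
    rintro ⟨g, h⟩
    have hg : g ∈ (I.map (MonoidHom.snd N K)).comap (MonoidHom.inl _ _) :=
      Subgroup.pi_mem_of_mulSingle_mem g fun r => hl r (g r)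
    have := mul_mem (Subgroup.mem_comap.mp hg) (hr h)
    rwa [show MonoidHom.inl _ _ g * ((1, h) : K) = (g, h) from
      Prod.ext (mul_one g) (one_mul h)] at this
  have hI2 : ∀ y : K, ∃ x : N, (x, y) ∈ I := fun y => by
    obtain ⟨⟨x, y'⟩, hxy, rfl⟩ := hKtop y
    exact ⟨x, hxy⟩
  have hI1 : ∀ x : N, ∃ y : K, (x, y) ∈ I := by
    have hle : P.powSubgroup q q' ≤ R.map (MonoidHom.fst _ _) := by
      rw [powSubgroup, Subgroup.closure_le]
      rintro _ (⟨r | s, rfl⟩ | ⟨r | s, rfl⟩)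
      · exact ⟨_, hRZ r ⟨_, clockZ_mem_pauliOneExt hζ (hdvd _)⟩ rfl, rfl⟩
      · exact ⟨_, hRZ' s, rfl⟩
      · exact ⟨_, hRX r ⟨_, shiftX_mem_pauliOneExt hζ (hdvd _)⟩ rfl, rfl⟩
      · exact ⟨_, hRX' s, rfl⟩
    intro x
    obtain ⟨x₀, hx₀, hτ⟩ := mem_tauImage.mp ((P.mem_normalizer_iff_mem_tauImage hd).mp x.2)
    -- An element of the normaliser has the same image under `τ` as some product of the `Z_i ^ q_i`
    -- and `X_i ^ q'_i`, hence differs from it by a power of `ζ`.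
    obtain ⟨f, hf⟩ := eq_zpow_pauliZeta_of_tau hζ (g := x.1 * x₀⁻¹) (by
      rw [map_mul, map_inv, mul_inv_eq_one]
      exact hτ.symm)
    have hx : x.1 ∈ R.map (MonoidHom.fst _ _) := by
      rw [mul_inv_eq_iff_eq_mul.mp hf]
      exact mul_mem (zpow_mem (Subgroup.mem_map.mpr ⟨_, hRζ, rfl⟩) f) (hle hx₀)
    obtain ⟨⟨x', y⟩, hxy, hx'⟩ := hx
    refine ⟨y, ?_⟩
    change x' = x.1 at hx'
    rw [hx'] at hxy
    exact hxy
  have hA : ∀ x : N, x ∈ (P.powSubgroup (fun i => C i * q i) fun i => C i * q' i).subgroupOf N ↔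
      (x, 1) ∈ I := by
    intro x
    rw [Subgroup.mem_subgroupOf]
    constructor
    · intro hx w
      change pauliAct x.1 _ = ((U.symm (mixedAct 1 1 w) : stabSpace _) : QuditSpace d n)
      rw [mixedAct_one]
      exact (U.symm w).2 x.1 hx
    · intro hx
      refine P.mem_of_fixes (dvd_mul_of_factor hd) fun v hv => ?_
      have h1 : pauliAct x.1 (U.symm (U ⟨v, hv⟩) : QuditSpace d n) =
        ((U.symm (mixedAct 1 1 (U ⟨v, hv⟩)) : stabSpace _) : QuditSpace d n) := hx (U ⟨v, hv⟩)
      rwa [mixedAct_one, U.symm_apply_apply] at h1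
  have hgoursat : ∀ y : K, y ∈ I.goursatSnd ↔ ((1 : pauli d n ζ), y) ∈ R := fun y =>
    Subgroup.mem_goursatSnd
  have hB : ∀ y : K, y ∈ zetaRel (G := fun r => pauliOneExt d (C (Sum.inl r)) ζ)
      (fun r => pauliOneExtZeta d (C (Sum.inl r)) ζ) (pauliZeta d l ζ) ↔ (1, y) ∈ I := by
    -- Normality of the right kernel, which follows from surjectivity onto `K`, reduces one
    -- inclusion to the defining `ζ`-relations.
    have hnorm : I.goursatSnd.Normal := Subgroup.normal_goursatSnd fun y => by
      obtain ⟨x, hx⟩ := hI2 y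
      exact ⟨⟨(x, y), hx⟩, rfl⟩
    intro y
    constructor
    · intro hy
      refine Subgroup.mem_goursatSnd.mp (Subgroup.normalClosure_le_normal (N := I.goursatSnd) ?_ hy)
      rintro _ ⟨r, rfl⟩
      refine (hgoursat _).mpr ?_
      -- The scalar `ζ` on `V^H` corresponds both to `ζ` in the factor `r` and to `ζ` in the last
      -- factor; the quotient of the two pairs lies over 1.
      have := mul_mem (hRζ' r) (inv_mem hRζ)
      simpa using this
    · intro hy
      obtain ⟨g, h⟩ := y
      refine mem_zetaRel_of_mixedMat (fun r => hC0 _) ?_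
      have h1 : mixedAct g h = LinearMap.id := LinearMap.ext fun w => by
        have h2 : pauliAct (1 : pauli d n ζ) (U.symm w : QuditSpace d n) = U.symm (mixedAct g h w) :=
          hy w
        rw [pauliAct_one] at h2
        exact (U.symm.injective (Subtype.ext h2)).symm
      rw [mixedAct_eq, ← Matrix.toLpLin_one] at h1
      exact Matrix.toEuclideanLin.injective h1
  obtain ⟨Φ, hΦ⟩ := exists_quotient_equiv hI1 hI2 hA hB
  have h1 : ∀ x : N, x.1 = pauliZeta d n ζ →
      Φ (QuotientGroup.mk x) = QuotientGroup.mk (1, pauliZeta d l ζ) := by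
    intro x hx
    refine (hΦ x (1, pauliZeta d l ζ)).mpr ?_
    change (x.1, _) ∈ R
    rw [hx]
    exact hRζ
  have h2 : ∀ (x : N) (g : ∀ r, pauliOneExt d (C (Sum.inl r)) ζ) (h : pauli d l ζ),
        Φ (QuotientGroup.mk x) = QuotientGroup.mk (g, h) → (x.1, (g, h)) ∈ R := by
    intro x g h hx
    exact (hΦ x (g, h)).mp hx
  exact ⟨Φ, U, h1, h2⟩

end PauliFrame

/-! ### The frame of a twisted free subgroup -/

/-- Both sides are linear in `m`, so this follows by evaluating on the symplectic basis itself. -/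
lemma sum_sympForm_basis {d n : ℕ} {B : Module.Basis (Fin n ⊕ Fin n) (ZMod d) (PhaseSpace d n)}
    (hB : IsSymplecticBasis B) (m : PhaseSpace d n) :
    ∑ i, (sympForm m (B (Sum.inr i)) • B (Sum.inl i) +
      sympForm (B (Sum.inl i)) m • B (Sum.inr i)) = m := by
  have h : ∑ i, ((sympFormLeft (B (Sum.inr i))).smulRight (B (Sum.inl i)) +
      (sympFormRight (B (Sum.inl i))).smulRight (B (Sum.inr i))) = LinearMap.id := by
    refine B.ext fun j => ?_
    have hl : ∀ p q : PhaseSpace d n, sympFormLeft q p = sympForm p q := fun _ _ => rfl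
    have hr : ∀ p q : PhaseSpace d n, sympFormRight p q = sympForm p q := fun _ _ => rfl
    rcases j with j | j
    · simp [hl, hr, (hB _ _).1, (hB _ _).2.2]
    · simp [hl, hr, (hB _ _).2.1, (hB _ _).2.2]
  have := LinearMap.congr_fun h m
  rw [LinearMap.sum_apply] at this
  exact this

/-- The frame given by lifts of a symplectic basis, reindexed by `σ`. -/
noncomputable def frameOfBasis {d n : ℕ} [NeZero d] {ζ : ℂˣ} (hζ : IsPrimitiveRoot ζ (dbar d))
    {ι : Type*} [Fintype ι] [DecidableEq ι] (σ : ι ≃ Fin n)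
    {B : Module.Basis (Fin n ⊕ Fin n) (ZMod d) (PhaseSpace d n)} (hB : IsSymplecticBasis B)
    {Z' X' : Fin n → pauli d n ζ}
    (hZ : ∀ i, tau d n hζ (Z' i) = Multiplicative.ofAdd (B (Sum.inl i)) ∧ Z' i ^ d = 1)
    (hX : ∀ i, tau d n hζ (X' i) = Multiplicative.ofAdd (B (Sum.inr i)) ∧ X' i ^ d = 1) :
    PauliFrame (n := n) hζ ι where
  Z i := Z' (σ i)
  X i := X' (σ i)
  E i := B (Sum.inl (σ i))
  F i := B (Sum.inr (σ i))
  tau_Z i := (hZ _).1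
  tau_X i := (hX _).1
  pow_Z i := (hZ _).2
  pow_X i := (hX _).2
  form_EE i j := (hB _ _).1
  form_FF i j := (hB _ _).2.1
  form_EF i j := by simp [(hB _ _).2.2]
  expand m := by
    conv_rhs => rw [← sum_sympForm_basis hB m]
    exact Equiv.sum_comp σ fun i => sympForm m (B (Sum.inr i)) • B (Sum.inl i) +
      sympForm (B (Sum.inl i)) m • B (Sum.inr i)

/-- With `c = a b / d` this gives the normal form `a = c q`, `b = c q'`, `d = c q q'` for `q = d /
b` and `q' = d / a`. -/
lemma mul_div_mul_div_eq {a b d : ℕ} (hd : 0 < d) (ha : a ∣ d) (hb : b ∣ d) (h : d ∣ a * b) :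
    a * b / d * (d / b) = a ∧ a * b / d * (d / a) = b ∧ a * b / d * (d / b) * (d / a) = d := by
  have key : ∀ {a b : ℕ}, b ∣ d → d ∣ a * b → a * b / d * (d / b) = a := by
    rintro a b ⟨b', hb'⟩ ⟨c, hc⟩
    have hb0 : 0 < b := Nat.pos_of_ne_zero (by rintro rfl; omega)
    rw [hc, Nat.mul_div_cancel_left _ hd]
    have h1 : d / b = b' := by rw [hb', Nat.mul_div_cancel_left _ hb0]
    rw [h1]
    refine Nat.eq_of_mul_eq_mul_left hd ?_
    rw [← mul_assoc, ← hc, mul_assoc, ← hb', mul_comm]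
  refine ⟨key hb h, ?_, ?_⟩
  · rw [mul_comm a b]
    exact key ha (by rwa [mul_comm])
  · rw [key hb h, Nat.mul_div_cancel' ha]

/-- A twisted free subgroup in terms of a frame indexed by `Fin k ⊕ Fin (n - k)`. -/
lemma IsTwistedFree.exists_frame {d n k : ℕ} [NeZero d] {ζ : ℂˣ}
    {hζ : IsPrimitiveRoot ζ (dbar d)} {hk : k ≤ n} {a b : Fin k → ℕ} {H : Subgroup (pauli d n ζ)}
    (hH : IsTwistedFree hζ hk a b H) :
    ∃ P : PauliFrame (n := n) hζ (Fin k ⊕ Fin (n - k)),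
      H = P.powSubgroup (Sum.elim a fun _ => d) (Sum.elim b fun _ => d) := by
  obtain ⟨-, B, Z', X', hB, hZ, hX, rfl⟩ := hH
  let σ : Fin k ⊕ Fin (n - k) ≃ Fin n :=
    finSumFinEquiv.trans (finCongr (Nat.add_sub_cancel' hk))
  have hσ : ∀ r, σ (Sum.inl r) = Fin.castLE hk r := fun r => Fin.ext rfl
  refine ⟨frameOfBasis hζ σ hB hZ hX, le_antisymm ?_ ?_⟩
  · rw [Subgroup.closure_le]
    rintro _ (⟨r, rfl⟩ | ⟨r, rfl⟩)
    · exact Subgroup.subset_closure (Or.inl ⟨Sum.inl r, congrArg (fun i => Z' i ^ a r) (hσ r)⟩)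
    · exact Subgroup.subset_closure (Or.inr ⟨Sum.inl r, congrArg (fun i => X' i ^ b r) (hσ r)⟩)
  · rw [PauliFrame.powSubgroup, Subgroup.closure_le]
    rintro _ (⟨r | s, rfl⟩ | ⟨r | s, rfl⟩)
    · exact Subgroup.subset_closure (Or.inl ⟨r, (congrArg (fun i => Z' i ^ a r) (hσ r)).symm⟩)
    -- The additional generators are `d`-th powers of lifts, hence trivial; they do not enlarge `H`.
    · have : (frameOfBasis hζ σ hB hZ hX).Z (Sum.inr s) ^ d = 1 := PauliFrame.pow_Z _ _
      change (frameOfBasis hζ σ hB hZ hX).Z (Sum.inr s) ^ d ∈ _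
      rw [this]
      exact one_mem _
    · exact Subgroup.subset_closure (Or.inr ⟨r, (congrArg (fun i => X' i ^ b r) (hσ r)).symm⟩)
    · have : (frameOfBasis hζ σ hB hZ hX).X (Sum.inr s) ^ d = 1 := PauliFrame.pow_X _ _
      change (frameOfBasis hζ σ hB hZ hX).X (Sum.inr s) ^ d ∈ _
      rw [this]
      exact one_mem _

/-- Families indexed by a disjoint union are pairs of families. -/
def sumPiAddEquiv {κ μ : Type*} (M : κ ⊕ μ → Type*) [∀ i, AddCommGroup (M i)] :
    (∀ i, M i) ≃+ (∀ r, M (Sum.inl r)) × ∀ s, M (Sum.inr s) where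
  toEquiv := Equiv.sumPiEquivProdPi M
  map_add' _ _ := rfl

end QuditPauli

/-! ### The structure theorem -/

theorem mainTheorem6 (d n k : ℕ) [NeZero d] (ζ : ℂˣ) (hζ : IsPrimitiveRoot ζ (dbar d))
    (hk : k ≤ n) (a b c : Fin k → ℕ) (H : Subgroup (pauli d n ζ))
    (hH : IsTwistedFree hζ hk a b H)
    (ha : ∀ r, a r ∣ d) (hb : ∀ r, b r ∣ d) (hc : ∀ r, c r = a r * b r / d) :
    tauImage hζ H ≤ perp (tauImage hζ H) ∧
    (∃ Ψ : (perp (tauImage hζ H) ⧸ (tauImage hζ H).addSubgroupOf (perp (tauImage hζ H))) ≃+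
        (∀ r, ZMod (c r) × ZMod (c r)) × (Fin (n - k) → ZMod d × ZMod d),
      ∀ p q : perp (tauImage hζ H),
        sumForm d c (Ψ (QuotientAddGroup.mk p)) (Ψ (QuotientAddGroup.mk q)) =
          sympForm p.1 q.1) ∧
    (∃ (Φ : NormQuot H ≃* PauliProd d (n - k) ζ c)
        (U : stabSpace H ≃ₗᵢ[ℂ] MixedSpace d (n - k) c),
      (∀ x : Subgroup.normalizer (H : Set (pauli d n ζ)), (x : pauli d n ζ) = pauliZeta d n ζ →
        Φ (QuotientGroup.mk x) = QuotientGroup.mk (1, pauliZeta d (n - k) ζ)) ∧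
      ∀ (x : Subgroup.normalizer (H : Set (pauli d n ζ)))
        (g : ∀ r, pauliOneExt d (c r) ζ) (h : pauli d (n - k) ζ),
        Φ (QuotientGroup.mk x) = QuotientGroup.mk (g, h) →
        ∀ w : MixedSpace d (n - k) c,
          pauliAct (x : pauli d n ζ) (U.symm w : QuditSpace d n) =
            (U.symm (mixedAct g h w) : QuditSpace d n)) := by
  have hab := hH.1
  obtain ⟨P, hP⟩ := hH.exists_frame
  have hnum := fun r => mul_div_mul_div_eq (NeZero.pos d) (ha r) (hb r) (hab r).2.2
  -- The free qudits get `C = d` and `q = q' = 1`, which matches the exponent `d` of their trivial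
  -- generators.
  let C : Fin k ⊕ Fin (n - k) → ℕ := Sum.elim c fun _ => d
  let q : Fin k ⊕ Fin (n - k) → ℕ := Sum.elim (fun r => d / b r) fun _ => 1
  let q' : Fin k ⊕ Fin (n - k) → ℕ := Sum.elim (fun r => d / a r) fun _ => 1
  have hα : Sum.elim a (fun _ => d) = fun i => C i * q i := by
    funext i
    rcases i with r | s
    · change a r = c r * (d / b r)
      rw [hc, (hnum r).1]
    · exact (mul_one d).symm
  have hβ : Sum.elim b (fun _ => d) = fun i => C i * q' i := by
    funext i
    rcases i with r | s
    · change b r = c r * (d / a r)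
      rw [hc, (hnum r).2.1]
    · exact (mul_one d).symm
  have hd : ∀ i, C i * q i * q' i = d := by
    rintro (r | s)
    · change c r * (d / b r) * (d / a r) = d
      rw [hc, (hnum r).2.2]
    · change d * 1 * 1 = d
      rw [mul_one, mul_one]
  rw [hα, hβ] at hP
  subst hP
  refine ⟨P.tauImage_le_perp (PauliFrame.dvd_mul_of_factor hd), ?_, ?_⟩
  · obtain ⟨Ψ, hΨ⟩ := P.exists_perpQuotient_equiv hd
    refine ⟨Ψ.trans (sumPiAddEquiv fun i => ZMod (C i) × ZMod (C i)), fun m p => ?_⟩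
    rw [← hΨ m p, Fintype.sum_sum_type]
    rfl
  · exact P.exists_normQuot_equiv (Nat.add_sub_cancel' hk) hd fun _ => rfl
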